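/- **Setting.** Let $(\Omega,\mathcal F,P)$ be a probability space ($P$ the risk-neutral measure). Write $\Phi$ for the standard normal distribution function, $\pi_n(\alpha)=e^{-\alpha}\alpha^n/n!$, and for $P_0,K,v>0$ let $$BS(P_0,K,r,T,v,q)=P_0e^{-qT}\Phi(d_1)-Ke^{-rT}\Phi(d_2),\qquad d_1=\frac{\log(P_0/K)+(r-q)T+v/2}{\sqrt v},\quad d_2=d_1-\sqrt v$$ be the Black–Scholes call price (initial price $P_0$, strike $K$, rate $r$, maturity $T$, terminal variance $v$, dividend yield $q$). The price at time $0$ of a European call on a spot $S$ is $c(0)=e^{-rT}\,\mathbb E[(S(T)-K)^+]$, with $K>0$, $T>0$, $r\in\mathbb R$. In all three cases below the analogous formulas hold for the put, with payoff $(K-S(T))^+$ and the Black–Scholes put price $Ke^{-rT}\Phi(-d_2)-P_0e^{-qT}\Phi(-d_1)$ in place of $BS$. All the stated expectations are finite and all the series converge absolutely. For each single asset (cases 1 and 2), $W$ is a standard Brownian motion, $N$ a Poisson process with intensity $\lambda\ge0$, and the marks are i.i.d. Gaussian; $W$, $N$ and the marks are independent. Nothing is assumed on the dependence between different assets. **1.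 Geometric Ornstein–Uhlenbeck process plus jumps.** Let $k,\sigma>0$, $\nu\ge 0$, $M,U(0)\in\mathbb R$ be constants, $Y^n\sim N(M,\nu^2)$ i.i.d., $F(0,\cdot)>0$ a forward curve, $h$ a deterministic function and $$S(t)=F(0,t)e^{U(t)+h(t)},\quad U=U^C+U^D,\quad U^C(t)=U(0)e^{-kt}+\sigma\int_0^te^{-k(t-s)}dW(s),\quad U^D(t)=e^{-kt}\sum_{n=1}^{N(t)}Y^n .$$ Put $$a(t)=U(0)e^{-kt}+\tfrac12\,\frac{\sigma^2}{2k}\bigl(1-e^{-2kt}\bigr),\qquad b(t)=\lambda t\Bigl(e^{e^{-kt}(M+\frac12e^{-kt}\nu^2)}-1\Bigr).$$ For every $T\ge0$: $\mathbb E[U^C(T)]=U(0)e^{-kT}$, $\mathrm{Var}[U^C(T)]=\frac{\sigma^2}{2k}(1-e^{-2kT})$, $\mathbb E[e^{U^C(T)}]=e^{a(T)}$, $\mathbb E[e^{U^D(T)}]=e^{b(T)}$, and $$\mathbb E[S(T)]=F(0,T)\iff h(T)=-a(T)-b(T).$$ If $T>0$ and $\mathbb E[S(T)]=F(0,T)$,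 then $$c(0)=\sum_{n\ge0}\pi_n(\lambda T)\,BS\bigl(F(0,T)e^{p^n(T)},K,r,T,\ \mathrm{Var}[U^C(T)]+ne^{-2kT}\nu^2,\ r\bigr),$$ $$p^n(t)=-b(t)+ne^{-kt}\bigl(\tfrac12e^{-kt}\nu^2+M\bigr).$$ (The dividend argument is $r$ because the starting value is a forward price; equivalently, one may take starting value $e^{-rT}F(0,T)e^{p^n(T)}$ and dividend yield $0$.) **2. Geometric Brownian motion plus jumps (Merton).** Let $S_0,\sigma,M>0$, $\nu\ge0$, $\mu,r\in\mathbb R$, $Z^n\sim N(0,1)$ i.i.d., $J^n=M\exp(-\nu^2/2+\nu Z^n)$ and $$S(t)=\exp\Bigl[\log S_0+(\mu-\tfrac12\sigma^2)t+\sigma W(t)+\sum_{n=1}^{N(t)}\log J^n\Bigr].$$ Then $\mathbb E[J^n]=M$, and for every $T>0$: $\mathbb E[S(T)]=S_0e^{rT}\iff\mu-r=-\lambda\,\mathbb E[J^1-1]$. Under this condition, for every $T>0$, $$c(0)=\sum_{n\ge0}\pi_n(\lambda T)\,BS\bigl(S_0M^ne^{\lambda T(1-M)},K,r,T,\ \sigma^2T+n\nu^2,\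 0\bigr).$$ **3. Schwartz–Smith model plus jumps.** Let $(W_1,W_2)$ be Brownian motions, jointly Gaussian with $dW_1dW_2=\rho\,dt$, $\rho\in[-1,1]$; $N_1,N_2$ Poisson processes with intensities $\lambda_1,\lambda_2\ge0$ and an arbitrary joint law; $Y_1^n,Y_2^n$ ($n\ge1$) all i.i.d. $N(M,\nu^2)$, $\nu\ge0$; the pair $(W_1,W_2)$, the pair $(N_1,N_2)$ and the marks independent. Let $k,\sigma_1,\sigma_2>0$, $\mu,M,U_1(0),U_2(0)\in\mathbb R$ be constants, $F(0,\cdot)>0$, $h$ deterministic, $S(t)=F(0,t)e^{h(t)+U^C(t)+U^D(t)}$ with $$U^C(t)=U_1(0)e^{-kt}+\sigma_1\int_0^te^{-k(t-s)}dW_1(s)+U_2(0)+\mu t+\sigma_2W_2(t),\qquad U^D(t)=e^{-kt}\sum_{n=1}^{N_1(t)}Y_1^n+\sum_{n=1}^{N_2(t)}Y_2^n .$$ Put $\phi_Y(u)=e^{Mu+\frac12\nu^2u^2}$ and $$V(t)=\frac{\sigma_1^2}{2k}(1-e^{-2kt})+\sigma_2^2t+\frac{2\rho\sigma_1\sigma_2}{k}(1-e^{-kt}),\qquad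 a(t)=U_1(0)e^{-kt}+U_2(0)+\mu t+\tfrac12V(t),$$ $$b(t)=\log\sum_{m_1,m_2\ge0}P(N_1(t)=m_1,N_2(t)=m_2)\,\phi_Y(e^{-kt})^{m_1}\phi_Y(1)^{m_2},$$ where the series converges. For every $T\ge0$: $\mathbb E[U^C(T)]=U_1(0)e^{-kT}+U_2(0)+\mu T$, $\mathrm{Var}[U^C(T)]=V(T)$, $\mathbb E[e^{U^C(T)}]=e^{a(T)}$, $\mathbb E[e^{U^D(T)}]=e^{b(T)}$, and $\mathbb E[S(T)]=F(0,T)\iff h(T)=-a(T)-b(T)$. If $T>0$ and $\mathbb E[S(T)]=F(0,T)$, then $$c(0)=\sum_{n_1,n_2\ge0}P(N_1(T)=n_1,N_2(T)=n_2)\,BS\bigl(F(0,T)e^{p^{(n_1,n_2)}(T)},K,r,T,\ \mathrm{Var}[U^C(T)]+(e^{-2kT}n_1+n_2)\nu^2,\ r\bigr),$$ $$p^{(n_1,n_2)}(t)=-b(t)+n_1e^{-kt}\bigl(M+e^{-kt}\tfrac{\nu^2}2\bigr)+n_2\bigl(M+\tfrac{\nu^2}2\bigr).$$ -/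

import Mathlib

open MeasureTheory ProbabilityTheory Filter
open scoped Topology NNReal ENNReal Nat

noncomputable section

/-! ### Poisson processes and Wiener integrals -/

/-- A (homogeneous) Poisson process with intensity `lam`: it starts at `0`, has independent
increments, its increment over `(s, t]` is Poisson with parameter `lam * (t - s)`, and its paths
are almost surely nondecreasing and right-continuous. -/
structure IsPoissonProcess {Ω : Type*} [MeasurableSpace Ω]
    (N : ℝ≥0 → Ω → ℕ) (lam : ℝ≥0) (P : Measure Ω) : Prop where
  measurable : ∀ t, Measurable (N t)
  zero : ∀ᵐ ω ∂P, N 0 ω = 0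
  indep_increments : HasIndepIncrements (fun t ω ↦ (N t ω : ℝ)) P
  law_increment : ∀ s t : ℝ≥0, s ≤ t →
    HasLaw (fun ω ↦ N t ω - N s ω) (poissonMeasure (lam * (t - s))) P
  monotone_paths : ∀ᵐ ω ∂P, Monotone (fun t ↦ N t ω)
  right_continuous : ∀ᵐ ω ∂P, ∀ t, ContinuousWithinAt (fun s ↦ N s ω) (Set.Ici t) t

/-- Deterministic step functions `∑ j < n, value j * 1_{(node j, node (j+1)]}`. -/
structure WienerStep where
  n : ℕ
  node : ℕ → ℝ≥0
  node_mono : Monotone node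
  value : ℕ → ℝ

/-- The step function as a function on the real line. -/
def WienerStep.toFun (g : WienerStep) (s : ℝ) : ℝ :=
  ∑ j ∈ Finset.range g.n,
    (Set.Ioc (g.node j : ℝ) (g.node (j + 1) : ℝ)).indicator (fun _ ↦ g.value j) s

/-- The elementary integral `∑ j < n, value j * (W (node (j+1)) - W (node j))`. -/
def WienerStep.integral {Ω : Type*} (g : WienerStep) (W : ℝ≥0 → Ω → ℝ) (ω : Ω) : ℝ :=
  ∑ j ∈ Finset.range g.n, g.value j * (W (g.node (j + 1)) ω - W (g.node j) ω)

/-- `I = ∫₀ᵗ f(s) dW(s)`, the Wiener (Itô) integral of a deterministic integrand: there are step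
functions supported in `(0, t]` which converge to `f` in `L²((0, t])` and whose elementary
integrals converge to `I` in `L²(P)`. -/
def IsWienerIntegral {Ω : Type*} [MeasurableSpace Ω] (P : Measure Ω)
    (W : ℝ≥0 → Ω → ℝ) (t : ℝ≥0) (f : ℝ → ℝ) (I : Ω → ℝ) : Prop :=
  AEStronglyMeasurable I P ∧
  ∃ g : ℕ → WienerStep,
    (∀ m, (g m).node (g m).n ≤ t) ∧
    Tendsto (fun m ↦ eLpNorm (fun s ↦ (g m).toFun s - f s) 2
      (volume.restrict (Set.Ioc (0 : ℝ) t))) atTop (𝓝 0) ∧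
    Tendsto (fun m ↦ eLpNorm (fun ω ↦ (g m).integral W ω - I ω) 2 P) atTop (𝓝 0)

/-! ### The sources of randomness -/

/-- The random drivers of one asset: a Brownian motion `W`, a Poisson process `N` of intensity
`lam` and i.i.d. Gaussian marks `Y 0, Y 1, …` with mean `m` and variance `v`; the three families
are mutually independent. Nothing is assumed about the joint law with the drivers of any other
asset. -/
structure IsAssetDriver {Ω : Type*} [MeasurableSpace Ω] (P : Measure Ω)
    (W : ℝ≥0 → Ω → ℝ) (N : ℝ≥0 → Ω → ℕ) (Y : ℕ → Ω → ℝ)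
    (lam : ℝ≥0) (m : ℝ) (v : ℝ≥0) : Prop where
  measurable_W : ∀ t, Measurable (W t)
  measurable_Y : ∀ n, Measurable (Y n)
  brownian : IsBrownianReal W P
  poisson : IsPoissonProcess N lam P
  law_mark : ∀ n, HasLaw (Y n) (gaussianReal m v) P
  iIndep_mark : iIndepFun Y P
  indep_W : IndepFun (fun ω t ↦ W t ω) (fun ω ↦ ((fun t ↦ N t ω), (fun n ↦ Y n ω))) P
  indep_N : IndepFun (fun ω t ↦ N t ω) (fun ω n ↦ Y n ω) P

/-- The random drivers of the two-factor model: two Brownian motions `W 0, W 1` with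
`dW₀ dW₁ = ρ dt`, two Poisson processes `N 0, N 1` with intensities `lam 0, lam 1` and an arbitrary
joint law, and i.i.d. Gaussian marks `Y 0 n, Y 1 n` with mean `m` and variance `v`. The pair of
Brownian motions, the pair of Poisson processes and the family of marks are mutually
independent. -/
structure IsTwoFactorDriver {Ω : Type*} [MeasurableSpace Ω] (P : Measure Ω)
    (W : Fin 2 → ℝ≥0 → Ω → ℝ) (N : Fin 2 → ℝ≥0 → Ω → ℕ) (Y : Fin 2 → ℕ → Ω → ℝ)
    (ρ : ℝ) (lam : Fin 2 → ℝ≥0) (m : ℝ) (v : ℝ≥0) : Prop where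
  measurable_W : ∀ i t, Measurable (W i t)
  measurable_Y : ∀ i n, Measurable (Y i n)
  brownian : ∀ i, IsBrownianReal (W i) P
  gaussian : IsGaussianProcess (fun p : Fin 2 × ℝ≥0 ↦ W p.1 p.2) P
  covariance : ∀ s t : ℝ≥0, cov[W 0 s, W 1 t; P] = ρ * ((min s t : ℝ≥0) : ℝ)
  poisson : ∀ i, IsPoissonProcess (N i) (lam i) P
  law_mark : ∀ i n, HasLaw (Y i n) (gaussianReal m v) P
  iIndep_mark : iIndepFun (fun p : Fin 2 × ℕ ↦ Y p.1 p.2) P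
  indep_W : IndepFun (fun ω i t ↦ W i t ω)
    (fun ω ↦ ((fun i t ↦ N i t ω), (fun i n ↦ Y i n ω))) P
  indep_N : IndepFun (fun ω i t ↦ N i t ω) (fun ω i n ↦ Y i n ω) P

/-- The compound Poisson sum `∑_{n=1}^{N(t)} Y^n`; the marks are numbered from `0`. -/
def compoundSum {Ω : Type*} (N : ℝ≥0 → Ω → ℕ) (Y : ℕ → Ω → ℝ) (t : ℝ≥0) (ω : Ω) : ℝ :=
  ∑ n ∈ Finset.range (N t ω), Y n ω

/-! ### Option prices and the Black-Scholes formula -/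

/-- The standard normal distribution function. -/
def stdNormalCDF (x : ℝ) : ℝ := cdf (gaussianReal 0 1) x

/-- `d₁` of the Black-Scholes formula in terms of the terminal variance `v`. -/
def bsD1 (P₀ K r T v q : ℝ) : ℝ :=
  (Real.log (P₀ / K) + (r - q) * T + v / 2) / √v

/-- `d₂` of the Black-Scholes formula in terms of the terminal variance `v`. -/
def bsD2 (P₀ K r T v q : ℝ) : ℝ := bsD1 P₀ K r T v q - √v

/-- The Black-Scholes price of a European call with initial price `P₀`, strike `K`, risk-free rate
`r`, maturity `T`, terminal variance `v` and dividend yield `q`. -/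
def bsCall (P₀ K r T v q : ℝ) : ℝ :=
  P₀ * Real.exp (-q * T) * stdNormalCDF (bsD1 P₀ K r T v q) -
    K * Real.exp (-r * T) * stdNormalCDF (bsD2 P₀ K r T v q)

/-- The Black-Scholes price of a European put. -/
def bsPut (P₀ K r T v q : ℝ) : ℝ :=
  K * Real.exp (-r * T) * stdNormalCDF (-bsD2 P₀ K r T v q) -
    P₀ * Real.exp (-q * T) * stdNormalCDF (-bsD1 P₀ K r T v q)

/-- The risk-neutral price at time `0` of the payoff `X` paid at time `T`. -/
def riskNeutralPrice {Ω : Type*} [MeasurableSpace Ω] (P : Measure Ω)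
    (r : ℝ) (T : ℝ≥0) (X : Ω → ℝ) : ℝ :=
  Real.exp (-r * T) * ∫ ω, X ω ∂P

/-- The payoff of a European call. -/
def callPayoff {Ω : Type*} (K : ℝ) (X : Ω → ℝ) (ω : Ω) : ℝ := max (X ω - K) 0

/-- The payoff of a European put. -/
def putPayoff {Ω : Type*} (K : ℝ) (X : Ω → ℝ) (ω : Ω) : ℝ := max (K - X ω) 0

/-- The Poisson weights `π_n(α) = e^{-α} α^n / n!`. -/
def poissonWeight (n : ℕ) (α : ℝ) : ℝ := Real.exp (-α) * α ^ n / (n ! : ℝ)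

/-! ### Geometric Brownian motion plus jumps -/

/-- The jump factors `J^n = M exp(-ν²/2 + ν Z^n)`. -/
def gbmJump {Ω : Type*} (M : ℝ) (ν : ℝ≥0) (Z : ℕ → Ω → ℝ) (n : ℕ) (ω : Ω) : ℝ :=
  M * Real.exp (-(ν : ℝ) ^ 2 / 2 + ν * Z n ω)

/-- `S(t) = exp(log S₀ + (μ - σ²/2) t + σ W(t) + ∑_{n ≤ N(t)} log J^n)`. -/
def gbmSpot {Ω : Type*} (S₀ μ σ M : ℝ) (ν : ℝ≥0)
    (W : ℝ≥0 → Ω → ℝ) (N : ℝ≥0 → Ω → ℕ) (Z : ℕ → Ω → ℝ) (t : ℝ≥0) (ω : Ω) : ℝ :=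
  Real.exp (Real.log S₀ + (μ - σ ^ 2 / 2) * t + σ * W t ω +
    compoundSum N (fun n ω' ↦ Real.log (gbmJump M ν Z n ω')) t ω)

/-- The terminal variance `σ² T + n ν²` given `n` jumps. -/
def gbmVar (σ : ℝ) (ν : ℝ≥0) (T : ℝ) (n : ℕ) : ℝ := σ ^ 2 * T + n * (ν : ℝ) ^ 2

/-- The starting point `S₀ M^n exp(λ T (1 - M))` given `n` jumps. -/
def gbmStart (S₀ M : ℝ) (lam : ℝ≥0) (T : ℝ) (n : ℕ) : ℝ :=
  S₀ * M ^ n * Real.exp (lam * T * (1 - M))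

/-! ### Geometric Ornstein-Uhlenbeck process plus jumps -/

/-- The continuous part `U^C(t) = U(0) e^{-kt} + σ ∫₀ᵗ e^{-k(t-s)} dW(s)`, where `I t` is the
stochastic integral and `u₀ = U(0)`. -/
def gouCont {Ω : Type*} (u₀ k σ : ℝ) (I : ℝ≥0 → Ω → ℝ) (t : ℝ≥0) (ω : Ω) : ℝ :=
  u₀ * Real.exp (-k * t) + σ * I t ω

/-- The jump part `U^D(t) = e^{-kt} ∑_{n ≤ N(t)} Y^n`. -/
def gouJump {Ω : Type*} (k : ℝ) (N : ℝ≥0 → Ω → ℕ) (Y : ℕ → Ω → ℝ) (t : ℝ≥0) (ω : Ω) : ℝ :=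
  Real.exp (-k * t) * compoundSum N Y t ω

/-- `S(t) = F(0,t) exp(U(t) + h(t))`, for a forward curve `F = F(0, ·)`. -/
def forwardSpot {Ω : Type*} (F h : ℝ≥0 → ℝ) (U : ℝ≥0 → Ω → ℝ) (t : ℝ≥0) (ω : Ω) : ℝ :=
  F t * Real.exp (U t ω + h t)

/-- `a(t) = u₀ e^{-kt} + (1/2) (σ²/(2k)) (1 - e^{-2kt})`. -/
def gouA (u₀ k σ t : ℝ) : ℝ :=
  u₀ * Real.exp (-k * t) + (1 / 2) * (σ ^ 2 / (2 * k) * (1 - Real.exp (-2 * k * t)))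

/-- `b(t) = λ t (exp(e^{-kt} (M + (1/2) e^{-kt} ν²)) - 1)`. -/
def gouB (k : ℝ) (lam : ℝ≥0) (M : ℝ) (ν : ℝ≥0) (t : ℝ) : ℝ :=
  lam * t *
    (Real.exp (Real.exp (-k * t) * (M + (1 / 2) * Real.exp (-k * t) * (ν : ℝ) ^ 2)) - 1)

/-- `p^n(t) = -b(t) + n e^{-kt} ((1/2) e^{-kt} ν² + M)`. -/
def gouP (k : ℝ) (lam : ℝ≥0) (M : ℝ) (ν : ℝ≥0) (n : ℕ) (t : ℝ) : ℝ :=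
  -gouB k lam M ν t +
    n * Real.exp (-k * t) * ((1 / 2) * Real.exp (-k * t) * (ν : ℝ) ^ 2 + M)

/-! ### Schwartz-Smith model plus jumps -/

/-- The continuous part of `U = U₁ + U₂`:
`u₁ e^{-kt} + σ₁ ∫₀ᵗ e^{-k(t-s)} dW₁(s) + u₂ + μ t + σ₂ W₂(t)`; `W 0, W 1` stand for `W₁, W₂`. -/
def ssCont {Ω : Type*} (u₁ u₂ k μ σ₁ σ₂ : ℝ) (I : ℝ≥0 → Ω → ℝ) (W : Fin 2 → ℝ≥0 → Ω → ℝ)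
    (t : ℝ≥0) (ω : Ω) : ℝ :=
  gouCont u₁ k σ₁ I t ω + (u₂ + μ * t + σ₂ * W 1 t ω)

/-- The jump part `e^{-kt} ∑_{n ≤ N₁(t)} Y₁^n + ∑_{n ≤ N₂(t)} Y₂^n` of `U = U₁ + U₂`. -/
def ssJump {Ω : Type*} (k : ℝ) (N : Fin 2 → ℝ≥0 → Ω → ℕ) (Y : Fin 2 → ℕ → Ω → ℝ)
    (t : ℝ≥0) (ω : Ω) : ℝ :=
  gouJump k (N 0) (Y 0) t ω + compoundSum (N 1) (Y 1) t ω

/-- The variance of the continuous part: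
`σ₁²/(2k) (1 - e^{-2kt}) + σ₂² t + (2ρσ₁σ₂/k) (1 - e^{-kt})`. -/
def ssVarCont (k σ₁ σ₂ ρ t : ℝ) : ℝ :=
  σ₁ ^ 2 / (2 * k) * (1 - Real.exp (-2 * k * t)) + σ₂ ^ 2 * t +
    2 * ρ * σ₁ * σ₂ / k * (1 - Real.exp (-k * t))

/-- `a(t) = u₁ e^{-kt} + u₂ + μ t + (1/2) Var[U^C(t)]`. -/
def ssA (u₁ u₂ k μ σ₁ σ₂ ρ t : ℝ) : ℝ :=
  u₁ * Real.exp (-k * t) + u₂ + μ * t + (1 / 2) * ssVarCont k σ₁ σ₂ ρ t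

/-- The joint Poisson probabilities `P(N₁(t) = n₁, N₂(t) = n₂)`. -/
def jointWeight {Ω : Type*} [MeasurableSpace Ω] (P : Measure Ω) (N : Fin 2 → ℝ≥0 → Ω → ℕ)
    (t : ℝ≥0) (n : ℕ × ℕ) : ℝ :=
  P.real {ω | N 0 t ω = n.1 ∧ N 1 t ω = n.2}

/-- The moment generating function `φ_Y(u) = exp(M u + ν² u² / 2)` of the jump sizes. -/
def jumpMGF (M : ℝ) (ν : ℝ≥0) (u : ℝ) : ℝ := Real.exp (M * u + (1 / 2) * (ν : ℝ) ^ 2 * u ^ 2)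

/-- The terms `P(N₁(t) = m₁, N₂(t) = m₂) φ_Y(e^{-kt})^{m₁} φ_Y(1)^{m₂}` of the series of
`e^{b(t)}`. -/
def ssTerm {Ω : Type*} [MeasurableSpace Ω] (P : Measure Ω) (N : Fin 2 → ℝ≥0 → Ω → ℕ)
    (k M : ℝ) (ν : ℝ≥0) (t : ℝ≥0) (m : ℕ × ℕ) : ℝ :=
  jointWeight P N t m * jumpMGF M ν (Real.exp (-k * t)) ^ m.1 * jumpMGF M ν 1 ^ m.2

/-- `b(t)`, given by `e^{b(t)} = ∑ P(N₁(t) = m₁, N₂(t) = m₂) φ_Y(e^{-kt})^{m₁} φ_Y(1)^{m₂}`. -/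
def ssB {Ω : Type*} [MeasurableSpace Ω] (P : Measure Ω) (N : Fin 2 → ℝ≥0 → Ω → ℕ)
    (k M : ℝ) (ν : ℝ≥0) (t : ℝ≥0) : ℝ :=
  Real.log (∑' m : ℕ × ℕ, ssTerm P N k M ν t m)

/-- `-b(t) + n₁ e^{-kt} (M + e^{-kt} ν²/2) + n₂ (M + ν²/2)`. -/
def ssP {Ω : Type*} [MeasurableSpace Ω] (P : Measure Ω) (N : Fin 2 → ℝ≥0 → Ω → ℕ)
    (k M : ℝ) (ν : ℝ≥0) (n : ℕ × ℕ) (t : ℝ≥0) : ℝ :=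
  -ssB P N k M ν t +
    n.1 * Real.exp (-k * t) * (M + Real.exp (-k * t) * (ν : ℝ) ^ 2 / 2) +
    n.2 * (M + (ν : ℝ) ^ 2 / 2)

end

/-! All three models have the same structure at a fixed maturity: the log-price is `C + D κ`, where
`C` is Gaussian, `κ` is the number of jumps (a pair of numbers for two factors), and `D i` is the
Gaussian total of the first `i` marks. Given `κ = i` the spot is lognormal, so every expectation is
a `κ`-weighted sum of lognormal expectations. Conditional expectations are not needed: the fibres of
`κ` partition the space, and on each fibre the independence of `κ` from one fixed variable factors
the integral (`hasSum_mixture`). `HasSum` over the reals is unconditional, hence absolute,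
convergence.

Each term is a Black-Scholes price. Multiplying a Gaussian density by `exp` shifts its mean by the
variance, which gives the call (`bsCall_eq_integral`); the put follows by parity. Only the forward
price and the variance have to be matched, so the models differ only in bookkeeping. Exponential
moments are the special case with payoff `exp`; there the sum over jumps is a generating function of
`κ`.

Two inputs concern the continuous part. First, the Wiener integral, possibly plus a correlated
Brownian value, is Gaussian with the expected variance: this holds for step functions and passes to
`L²` limits (`IsWienerIntegral.hasLaw_add`). Second, it agrees almost everywhere with a measurable
functional of the driving path (`IsWienerIntegral.exists_ae_eq_comp`), so it inherits independence
from the jumps. The Black-Scholes formula also needs a nonzero variance; with two factors this is a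
strict Cauchy-Schwarz type inequality (`ssVarCont_pos`). -/

/-! ### Mixtures -/

section Mixture

variable {Ω ι : Type*} [MeasurableSpace Ω] {P : Measure Ω} [IsProbabilityMeasure P]
  [Countable ι] [MeasurableSpace ι] [MeasurableSingletonClass ι] {κ : Ω → ι} {Z : ι → Ω → ℝ}

-- The left side is the expectation of the product of an indicator function of `κ` with `X`, and
-- independence factors it.
omit [IsProbabilityMeasure P] [Countable ι] in
theorem setIntegral_fiber_eq_mul (hκ : Measurable κ) {i : ι} {X : Ω → ℝ}
    (hX : AEStronglyMeasurable X P) (hind : IndepFun κ X P) :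
    ∫ ω in κ ⁻¹' {i}, X ω ∂P = P.real (κ ⁻¹' {i}) * ∫ ω, X ω ∂P := by
  have hm : MeasurableSet (κ ⁻¹' {i}) := hκ (measurableSet_singleton i)
  have hφ : Measurable (Set.indicator {i} (fun _ : ι ↦ (1 : ℝ))) :=
    measurable_const.indicator (measurableSet_singleton i)
  have h := (hind.comp hφ measurable_id).integral_fun_mul_eq_mul_integral
    (hφ.comp hκ).aestronglyMeasurable hX
  have h1 : (Set.indicator {i} (fun _ : ι ↦ (1 : ℝ))) ∘ κ =
      (κ ⁻¹' {i}).indicator (fun _ ↦ (1 : ℝ)) := by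
    rfl
  simp only [h1] at h
  rw [integral_indicator hm] at h
  simp only [integral_const, smul_eq_mul, mul_one, measureReal_restrict_apply_univ, id,
    Function.comp_apply] at h
  rw [← h, ← integral_indicator hm]
  refine integral_congr_ae (.of_forall fun ω ↦ ?_)
  simp [Set.indicator]

omit [IsProbabilityMeasure P] in
theorem integrable_mixture (hκ : Measurable κ) (hZ : ∀ i, Integrable (Z i) P)
    (hind : ∀ i, IndepFun κ (Z i) P)
    (hs : Summable fun i ↦ P.real (κ ⁻¹' {i}) * ∫ ω, |Z i ω| ∂P) :
    Integrable (fun ω ↦ Z (κ ω) ω) P := by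
  have hm : ∀ i, MeasurableSet (κ ⁻¹' {i}) := fun i ↦ hκ (measurableSet_singleton i)
  have hU : ⋃ i, κ ⁻¹' {i} = Set.univ := by ext; simp
  rw [← integrableOn_univ, ← hU]
  refine integrableOn_iUnion_of_summable_integral_norm (fun i ↦ ?_) (hs.congr fun i ↦ ?_)
  · exact (hZ i).integrableOn.congr_fun (fun ω hω ↦ by rw [show κ ω = i from hω]) (hm i)
  · simp only [← Real.norm_eq_abs]
    refine (setIntegral_fiber_eq_mul (i := i) (X := fun ω ↦ ‖Z i ω‖) hκ (hZ i).1.norm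
      ((hind i).comp measurable_id measurable_norm)).symm.trans ?_
    exact setIntegral_congr_fun (hm i) fun ω hω ↦ by simp only [show κ ω = i from hω]

-- Countable additivity over the fibres of `κ`, on each of which the index is frozen. Independence
-- of `κ` from each `Z i` separately suffices; the joint law of the `Z i` plays no role.
omit [IsProbabilityMeasure P] in
theorem hasSum_mixture (hκ : Measurable κ) (hZ : ∀ i, AEStronglyMeasurable (Z i) P)
    (hind : ∀ i, IndepFun κ (Z i) P) (hint : Integrable (fun ω ↦ Z (κ ω) ω) P) :
    HasSum (fun i ↦ P.real (κ ⁻¹' {i}) * ∫ ω, Z i ω ∂P) (∫ ω, Z (κ ω) ω ∂P) := by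
  have hm : ∀ i, MeasurableSet (κ ⁻¹' {i}) := fun i ↦ hκ (measurableSet_singleton i)
  have hU : ⋃ i, κ ⁻¹' {i} = Set.univ := by ext; simp
  have hd : Pairwise (Function.onFun Disjoint fun i ↦ κ ⁻¹' {i}) := fun i j hij ↦
    Disjoint.preimage _ (by simpa using hij)
  have := hasSum_integral_iUnion (μ := P) hm hd (by rw [hU]; exact hint.integrableOn)
  rw [hU, setIntegral_univ] at this
  refine this.congr_fun fun i ↦ ?_
  rw [← setIntegral_fiber_eq_mul hκ (hZ i) (hind i)]
  exact setIntegral_congr_fun (hm i) fun ω hω ↦ by simp only [show κ ω = i from hω]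

end Mixture

/-! ### The Black-Scholes formula -/

/-- Standardizing with the decreasing map `x ↦ (m - x) / √v` turns the upper tail directly into a
lower tail, with the signs of `d₁` and `d₂`. -/
theorem gaussianReal_real_Ici (m a : ℝ) {v : ℝ≥0} (hv : v ≠ 0) :
    (gaussianReal m v).real (Set.Ici a) = stdNormalCDF ((m - a) / √v) := by
  have hs : 0 < √(v : ℝ) := Real.sqrt_pos.2 (by positivity)
  have h1 : HasLaw (fun x ↦ (m - x) / √v) (gaussianReal 0 1) (gaussianReal m v) := by
    have h := gaussianReal_div_const (gaussianReal_const_sub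
      (HasLaw.id (μ := gaussianReal m v)) m) (√v)
    convert h using 2
    · simp
    · simp
    · rw [← NNReal.coe_inj]
      simp [Real.sq_sqrt v.coe_nonneg, hv]
  rw [stdNormalCDF, cdf_eq_real, ← h1.map_eq,
    map_measureReal_apply_of_aemeasurable h1.aemeasurable measurableSet_Iic]
  congr 1
  ext x
  simp only [Set.mem_Ici, Set.mem_preimage, Set.mem_Iic]
  rw [div_le_div_iff_of_pos_right hs]
  constructor <;> intro h <;> linarith

theorem stdNormalCDF_neg (x : ℝ) : stdNormalCDF (-x) = 1 - stdNormalCDF x := by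
  have h : Set.Ici x = (Set.Iio x)ᶜ := by ext; simp
  have h1 := gaussianReal_real_Ici 0 x (v := 1) one_ne_zero
  have := nullSingletonClass_gaussianReal (μ := 0) (v := 1) one_ne_zero
  rw [h, probReal_compl_eq_one_sub measurableSet_Iio, measureReal_congr Iio_ae_eq_Iic] at h1
  rw [stdNormalCDF, stdNormalCDF, cdf_eq_real _ x, h1]
  simp [stdNormalCDF]

/-- Completing the square. This exponential tilt is the change of numéraire behind the difference
between `d₁` and `d₂`. -/
theorem exp_mul_gaussianPDFReal (m x : ℝ) {v : ℝ≥0} (hv : v ≠ 0) :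
    gaussianPDFReal m v x * Real.exp x =
      Real.exp (m + v / 2) * gaussianPDFReal (m + v) v x := by
  have hv' : (v : ℝ) ≠ 0 := by exact_mod_cast hv
  simp only [gaussianPDFReal_def]
  rw [mul_assoc, ← Real.exp_add, mul_left_comm, ← Real.exp_add]
  congr 2
  field_simp
  ring

theorem setIntegral_exp_gaussianReal (m a : ℝ) {v : ℝ≥0} (hv : v ≠ 0) :
    ∫ x in Set.Ici a, Real.exp x ∂(gaussianReal m v) =
      Real.exp (m + v / 2) * (gaussianReal (m + v) v).real (Set.Ici a) := by
  have h := fun (m' : ℝ) (f : ℝ → ℝ) ↦ integral_gaussianReal_eq_integral_smul (μ := m') (f := f) hv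
  rw [← integral_indicator measurableSet_Ici, h,
    ← integral_indicator_one (μ := gaussianReal (m + v) v) measurableSet_Ici, h,
    ← integral_const_mul]
  refine integral_congr_ae (.of_forall fun x ↦ ?_)
  by_cases hx : a ≤ x
  · simp [Set.indicator, hx, exp_mul_gaussianPDFReal m x hv]
  · simp [Set.indicator, hx]

theorem integral_exp_gaussianReal (m : ℝ) (v : ℝ≥0) :
    ∫ x, Real.exp x ∂(gaussianReal m v) = Real.exp (m + v / 2) := by
  have := congrFun (mgf_id_gaussianReal (μ := m) (v := v)) 1
  simpa [mgf] using this

theorem integrable_exp_gaussianReal (m : ℝ) (v : ℝ≥0) :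
    Integrable Real.exp (gaussianReal m v) := by
  simpa using integrable_exp_mul_gaussianReal (μ := m) (v := v) 1

theorem integrable_call_of_integrable {Ω : Type*} [MeasurableSpace Ω] {P : Measure Ω}
    [IsFiniteMeasure P] {X : Ω → ℝ} (K : ℝ) (hX : Integrable X P) :
    Integrable (callPayoff K X) P :=
  (hX.sub (integrable_const K)).sup (integrable_const 0)

theorem integrable_put_of_integrable {Ω : Type*} [MeasurableSpace Ω] {P : Measure Ω}
    [IsFiniteMeasure P] {X : Ω → ℝ} (K : ℝ) (hX : Integrable X P) :
    Integrable (putPayoff K X) P :=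
  ((integrable_const K).sub hX).sup (integrable_const 0)

/-- The option is exercised on the half-line above `log K`. The asset part is a tail of the tilted
Gaussian, the strike part a tail of the original one. -/
theorem integral_call_gaussianReal (m : ℝ) {K : ℝ} {v : ℝ≥0} (hv : v ≠ 0) (hK : 0 < K) :
    ∫ x, callPayoff K Real.exp x ∂(gaussianReal m v) =
      Real.exp (m + v / 2) * stdNormalCDF ((m + v - Real.log K) / √v) -
        K * stdNormalCDF ((m - Real.log K) / √v) := by
  have h1 : callPayoff K Real.exp =
      (Set.Ici (Real.log K)).indicator (fun x ↦ Real.exp x - K) := by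
    ext x
    simp only [callPayoff, Set.indicator, Set.mem_Ici, Real.log_le_iff_le_exp hK]
    split_ifs with h
    · exact max_eq_left (by linarith)
    · exact max_eq_right (by linarith)
  rw [h1, integral_indicator measurableSet_Ici,
    integral_sub (integrable_exp_gaussianReal m v).integrableOn (integrable_const K),
    setIntegral_exp_gaussianReal m _ hv, gaussianReal_real_Ici _ _ hv]
  simp [gaussianReal_real_Ici _ _ hv, mul_comm]

section BlackScholes

variable {P₀ K r T q m : ℝ} {v : ℝ≥0}

theorem bsD1_eq_of_forward (hK : 0 < K)
    (hF : P₀ * Real.exp ((r - q) * T) = Real.exp (m + v / 2)) :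
    bsD1 P₀ K r T v q = (m + v - Real.log K) / √v := by
  have hP : 0 < P₀ := by
    by_contra h
    nlinarith [Real.exp_pos ((r - q) * T), Real.exp_pos (m + (v : ℝ) / 2)]
  have := congrArg Real.log hF
  rw [Real.log_mul hP.ne' (Real.exp_pos _).ne', Real.log_exp, Real.log_exp] at this
  rw [bsD1, Real.log_div hP.ne' hK.ne']
  congr 1
  linarith

theorem bsD2_eq_of_forward (hv : v ≠ 0) (hK : 0 < K)
    (hF : P₀ * Real.exp ((r - q) * T) = Real.exp (m + v / 2)) :
    bsD2 P₀ K r T v q = (m - Real.log K) / √v := by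
  have hs : 0 < √(v : ℝ) := Real.sqrt_pos.2 (by positivity)
  rw [bsD2, bsD1_eq_of_forward hK hF]
  field_simp
  rw [Real.sq_sqrt v.coe_nonneg]
  ring

theorem bsCall_eq_integral (hv : v ≠ 0) (hK : 0 < K)
    (hF : P₀ * Real.exp ((r - q) * T) = Real.exp (m + v / 2)) :
    bsCall P₀ K r T v q =
      Real.exp (-r * T) * ∫ x, callPayoff K Real.exp x ∂(gaussianReal m v) := by
  rw [bsCall, integral_call_gaussianReal m hv hK, bsD1_eq_of_forward hK hF,
    bsD2_eq_of_forward hv hK hF, ← hF,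
    show -q * T = -r * T + (r - q) * T by ring, Real.exp_add]
  ring

theorem bsPut_eq_integral (hv : v ≠ 0) (hK : 0 < K)
    (hF : P₀ * Real.exp ((r - q) * T) = Real.exp (m + v / 2)) :
    bsPut P₀ K r T v q =
      Real.exp (-r * T) * ∫ x, putPayoff K Real.exp x ∂(gaussianReal m v) := by
  have hi := integrable_exp_gaussianReal m v
  -- Put-call parity, which holds pointwise for the payoffs.
  have h1 : ∫ x, putPayoff K Real.exp x ∂(gaussianReal m v) =
      ∫ x, (callPayoff K Real.exp x + (K - Real.exp x)) ∂(gaussianReal m v) := by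
    congr 1 with x
    simp only [putPayoff, callPayoff]
    rcases le_total (Real.exp x) K with h | h
    · rw [max_eq_left (by linarith), max_eq_right (by linarith)]; ring
    · rw [max_eq_right (by linarith), max_eq_left (by linarith)]; ring
  rw [h1, integral_add (integrable_call_of_integrable K hi) (g := fun x ↦ K - Real.exp x)
      ((integrable_const K).sub hi), mul_add,
    ← bsCall_eq_integral hv hK hF, integral_sub (integrable_const K) hi,
    integral_exp_gaussianReal, ← hF, bsCall, bsPut, stdNormalCDF_neg, stdNormalCDF_neg,
    show -q * T = -r * T + (r - q) * T by ring, Real.exp_add]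
  simp
  ring

end BlackScholes

/-! ### Exponentials of Gaussian mixtures -/

section GaussianMixture

variable {Ω ι : Type*} [MeasurableSpace Ω] {P : Measure Ω} [IsProbabilityMeasure P]
  [Countable ι] [MeasurableSpace ι] [MeasurableSingletonClass ι] {κ : Ω → ι} {X : ι → Ω → ℝ}
  {m : ι → ℝ} {v : ι → ℝ≥0}

omit [IsProbabilityMeasure P] in
theorem integral_exp_of_hasLaw {X : Ω → ℝ} {m : ℝ} {v : ℝ≥0} (hX : HasLaw X (gaussianReal m v) P) :
    Integrable (fun ω ↦ Real.exp (X ω)) P ∧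
      ∫ ω, Real.exp (X ω) ∂P = Real.exp (m + v / 2) := by
  constructor
  · have := integrable_exp_gaussianReal m v
    rw [← hX.map_eq] at this
    exact this.comp_aemeasurable hX.aemeasurable
  · rw [← integral_exp_gaussianReal]
    exact hX.integral_comp Real.measurable_exp.aestronglyMeasurable

omit [IsProbabilityMeasure P] in
theorem integral_exp_mixture (hκ : Measurable κ) (hX : ∀ i, HasLaw (X i) (gaussianReal (m i) (v i)) P)
    (hind : ∀ i, IndepFun κ (X i) P)
    (hs : Summable fun i ↦ P.real (κ ⁻¹' {i}) * Real.exp (m i + v i / 2)) :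
    Integrable (fun ω ↦ Real.exp (X (κ ω) ω)) P ∧
    HasSum (fun i ↦ P.real (κ ⁻¹' {i}) * Real.exp (m i + v i / 2))
      (∫ ω, Real.exp (X (κ ω) ω) ∂P) := by
  have hi : ∀ i, IndepFun κ (fun ω ↦ Real.exp (X i ω)) P := fun i ↦
    (hind i).comp measurable_id Real.measurable_exp
  have h1 : Integrable (fun ω ↦ Real.exp (X (κ ω) ω)) P := by
    refine integrable_mixture (Z := fun i ω ↦ Real.exp (X i ω)) hκ
      (fun i ↦ (integral_exp_of_hasLaw (hX i)).1) hi ?_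
    simpa only [Real.abs_exp, (integral_exp_of_hasLaw (hX _)).2] using hs
  refine ⟨h1, ?_⟩
  have := hasSum_mixture (Z := fun i ω ↦ Real.exp (X i ω)) hκ
    (fun i ↦ (integral_exp_of_hasLaw (hX i)).1.1) hi h1
  simpa only [(integral_exp_of_hasLaw (hX _)).2] using this

/-- The starting values `P₀ i` enter only through `hF`, which matches the forward price of the
`i`-th Black-Scholes model with the mean of the `i`-th lognormal. -/
theorem hasSum_optionPrices_mixture {K r q : ℝ} {T : ℝ≥0} {P₀ : ι → ℝ} (hK : 0 < K)
    (hκ : Measurable κ) (hX : ∀ i, HasLaw (X i) (gaussianReal (m i) (v i)) P)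
    (hind : ∀ i, IndepFun κ (X i) P) (hv : ∀ i, v i ≠ 0)
    (hF : ∀ i, P₀ i * Real.exp ((r - q) * T) = Real.exp (m i + v i / 2))
    (hint : Integrable (fun ω ↦ Real.exp (X (κ ω) ω)) P) :
    HasSum (fun i ↦ P.real (κ ⁻¹' {i}) * bsCall (P₀ i) K r T (v i) q)
      (riskNeutralPrice P r T (callPayoff K fun ω ↦ Real.exp (X (κ ω) ω))) ∧
    HasSum (fun i ↦ P.real (κ ⁻¹' {i}) * bsPut (P₀ i) K r T (v i) q)
      (riskNeutralPrice P r T (putPayoff K fun ω ↦ Real.exp (X (κ ω) ω))) := by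
  have hmc : Measurable (callPayoff K Real.exp) := by unfold callPayoff; fun_prop
  have hmp : Measurable (putPayoff K Real.exp) := by unfold putPayoff; fun_prop
  constructor
  · have := (hasSum_mixture (Z := fun i ω ↦ callPayoff K Real.exp (X i ω)) hκ
      (fun i ↦ (hmc.comp_aemeasurable (hX i).aemeasurable).aestronglyMeasurable)
      (fun i ↦ (hind i).comp measurable_id hmc)
      (integrable_call_of_integrable K hint)).mul_left (Real.exp (-r * T))
    refine this.congr_fun fun i ↦ ?_
    rw [bsCall_eq_integral (hv i) hK (hF i), ← (hX i).integral_comp hmc.aestronglyMeasurable]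
    simp only [Function.comp_apply]
    ring
  · have := (hasSum_mixture (Z := fun i ω ↦ putPayoff K Real.exp (X i ω)) hκ
      (fun i ↦ (hmp.comp_aemeasurable (hX i).aemeasurable).aestronglyMeasurable)
      (fun i ↦ (hind i).comp measurable_id hmp)
      (integrable_put_of_integrable K hint)).mul_left (Real.exp (-r * T))
    refine this.congr_fun fun i ↦ ?_
    rw [bsPut_eq_integral (hv i) hK (hF i), ← (hX i).integral_comp hmp.aestronglyMeasurable]
    simp only [Function.comp_apply]
    ring

end GaussianMixture

/-! ### Limits in `L²` -/

/-- The integral of a product is the `L²` inner product, which is jointly continuous. -/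
theorem tendsto_integral_mul_of_tendsto_eLpNorm {α : Type*} [MeasurableSpace α] {μ : Measure α}
    {u w : ℕ → α → ℝ} {u' w' : α → ℝ} (hu : ∀ n, MemLp (u n) 2 μ) (hw : ∀ n, MemLp (w n) 2 μ)
    (hu' : MemLp u' 2 μ) (hw' : MemLp w' 2 μ)
    (h1 : Tendsto (fun n ↦ eLpNorm (u n - u') 2 μ) atTop (𝓝 0))
    (h2 : Tendsto (fun n ↦ eLpNorm (w n - w') 2 μ) atTop (𝓝 0)) :
    Tendsto (fun n ↦ ∫ x, u n x * w n x ∂μ) atTop (𝓝 (∫ x, u' x * w' x ∂μ)) := by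
  have key : ∀ {f g : α → ℝ} (hf : MemLp f 2 μ) (hg : MemLp g 2 μ),
      inner ℝ (hf.toLp f) (hg.toLp g) = ∫ x, f x * g x ∂μ := by
    intro f g hf hg
    rw [L2.inner_def]
    refine integral_congr_ae ?_
    filter_upwards [hf.coeFn_toLp, hg.coeFn_toLp] with x hx hy
    simp [hx, hy, mul_comm]
  have l1 := (Lp.tendsto_Lp_iff_tendsto_eLpNorm'' u hu u' hu').2 h1
  have l2 := (Lp.tendsto_Lp_iff_tendsto_eLpNorm'' w hw w' hw').2 h2
  simpa only [key] using Tendsto.inner (𝕜 := ℝ) l1 l2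

/-- Convergence in `L²` implies convergence in distribution, hence of characteristic functions; the
Gaussian ones converge explicitly with their variances. -/
theorem hasLaw_gaussianReal_of_tendsto_eLpNorm {Ω : Type*} [MeasurableSpace Ω] {P : Measure Ω}
    [IsProbabilityMeasure P] {X : ℕ → Ω → ℝ} {Z : Ω → ℝ} {m : ℝ} {v : ℕ → ℝ≥0} {v' : ℝ≥0}
    (hX : ∀ n, HasLaw (X n) (gaussianReal m (v n)) P) (hZ : AEStronglyMeasurable Z P)
    (hlim : Tendsto (fun n ↦ eLpNorm (X n - Z) 2 P) atTop (𝓝 0))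
    (hv : Tendsto (fun n ↦ (v n : ℝ)) atTop (𝓝 v')) : HasLaw Z (gaussianReal m v') P := by
  have hd := (tendstoInMeasure_of_tendsto_eLpNorm (p := 2) (by simp)
    (fun n ↦ (hX n).aemeasurable.aestronglyMeasurable) hZ hlim).tendstoInDistribution
    (fun n ↦ (hX n).aemeasurable)
  refine ⟨hZ.aemeasurable, ?_⟩
  have := Measure.isProbabilityMeasure_map (μ := P) hZ.aemeasurable
  refine Measure.ext_of_charFun (funext fun t ↦ ?_)
  have h1 := ProbabilityMeasure.tendsto_iff_tendsto_charFun.1 hd.tendsto t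
  simp only [ProbabilityMeasure.coe_mk, (hX _).map_eq] at h1
  refine tendsto_nhds_unique h1 ?_
  simp only [charFun_gaussianReal]
  refine (Complex.continuous_exp.tendsto _).comp (tendsto_const_nhds.sub ?_)
  exact (((Complex.continuous_ofReal.tendsto _).comp hv).mul_const _).div_const _

/-! ### Step functions -/

namespace WienerStep

/-- The overlap length is written with `min` because `min` is the Brownian covariance kernel: the
Itô isometry for step functions then holds term by term, without separating equal from disjoint
intervals. -/
theorem integral_mul_indicator_Ioc {t a a' b b' : ℝ} (ha : 0 ≤ a) (ha' : a ≤ a') (hat : a' ≤ t)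
    (hb' : b ≤ b') (c d : ℝ) :
    ∫ s in Set.Ioc 0 t, (Set.Ioc a a').indicator (fun _ ↦ c) s *
        (Set.Ioc b b').indicator (fun _ ↦ d) s =
      c * d * (min a' b' - min a' b - min a b' + min a b) := by
  simp_rw [← Set.inter_indicator_mul]
  rw [setIntegral_indicator (measurableSet_Ioc.inter measurableSet_Ioc), Set.Ioc_inter_Ioc,
    Set.Ioc_inter_Ioc, setIntegral_const, Real.volume_real_Ioc, smul_eq_mul, mul_comm]
  congr 1
  simp only [min_def, max_def]
  split_ifs <;> linarith

theorem integral_indicator_Ioc {t a a' : ℝ} (ha : 0 ≤ a) (ha' : a ≤ a') (hat : a' ≤ t) (c : ℝ) :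
    ∫ s in Set.Ioc 0 t, (Set.Ioc a a').indicator (fun _ ↦ c) s = c * (a' - a) := by
  rw [setIntegral_indicator measurableSet_Ioc, Set.Ioc_inter_Ioc, sup_eq_right.2 ha,
    inf_eq_right.2 hat, setIntegral_const, Real.volume_real_Ioc_of_le ha', smul_eq_mul, mul_comm]

theorem memLp_toFun (g : WienerStep) (t : ℝ) :
    MemLp g.toFun 2 (volume.restrict (Set.Ioc 0 t)) := by
  have : g.toFun = fun s ↦ ∑ j ∈ Finset.range g.n,
      (Set.Ioc (g.node j : ℝ) (g.node (j + 1) : ℝ)).indicator (fun _ ↦ g.value j) s := rfl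
  rw [this]
  exact memLp_finsetSum _ fun j _ ↦ (memLp_const _).indicator measurableSet_Ioc

variable {g : WienerStep} {t : ℝ≥0}

theorem node_le (hg : g.node g.n ≤ t) {j : ℕ} (hj : j ≤ g.n) : g.node j ≤ t :=
  (g.node_mono hj).trans hg

theorem integral_toFun (hg : g.node g.n ≤ t) :
    ∫ s in Set.Ioc (0 : ℝ) t, g.toFun s =
      ∑ j ∈ Finset.range g.n, g.value j * (g.node (j + 1) - g.node j) := by
  unfold toFun
  rw [integral_finsetSum _ fun j _ ↦ (integrable_const _).indicator measurableSet_Ioc]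
  refine Finset.sum_congr rfl fun j hj ↦ integral_indicator_Ioc (by positivity)
    (by exact_mod_cast g.node_mono j.le_succ)
    (by exact_mod_cast node_le hg (Finset.mem_range.1 hj)) _

theorem integral_toFun_mul_toFun (hg : g.node g.n ≤ t) :
    ∫ s in Set.Ioc (0 : ℝ) t, g.toFun s * g.toFun s =
      ∑ i ∈ Finset.range g.n, ∑ j ∈ Finset.range g.n, g.value i * g.value j *
        (min (g.node (i + 1) : ℝ) (g.node (j + 1)) - min (g.node (i + 1) : ℝ) (g.node j) -
          min (g.node i : ℝ) (g.node (j + 1)) + min (g.node i : ℝ) (g.node j)) := by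
  unfold toFun
  simp_rw [Finset.sum_mul_sum]
  have hint : ∀ i j, Integrable (fun s ↦
      (Set.Ioc (g.node i : ℝ) (g.node (i + 1) : ℝ)).indicator (fun _ ↦ g.value i) s *
      (Set.Ioc (g.node j : ℝ) (g.node (j + 1) : ℝ)).indicator (fun _ ↦ g.value j) s)
      (volume.restrict (Set.Ioc (0 : ℝ) t)) := by
    intro i j
    simp_rw [← Set.inter_indicator_mul]
    exact (integrable_const _).indicator (measurableSet_Ioc.inter measurableSet_Ioc)
  rw [integral_finsetSum _ fun i _ ↦ integrable_finsetSum _ fun j _ ↦ hint i j]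
  refine Finset.sum_congr rfl fun i hi ↦ ?_
  rw [integral_finsetSum _ fun j _ ↦ hint i j]
  exact Finset.sum_congr rfl fun j hj ↦ integral_mul_indicator_Ioc (by positivity)
    (by exact_mod_cast g.node_mono i.le_succ)
    (by exact_mod_cast node_le hg (Finset.mem_range.1 hi))
    (by exact_mod_cast g.node_mono j.le_succ) _ _

variable {Ω : Type*} [MeasurableSpace Ω] {P : Measure Ω} [IsProbabilityMeasure P]
  {W : ℝ≥0 → Ω → ℝ} {B : Ω → ℝ}

omit [IsProbabilityMeasure P] in
theorem memLp_eval (hW : IsPreBrownianReal W P) (s : ℝ≥0) : MemLp (W s) 2 P :=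
  (hW.isGaussianProcess.hasGaussianLaw_eval s).memLp_two

omit [IsProbabilityMeasure P] in
theorem memLp_increment (hW : IsPreBrownianReal W P) (c : ℝ) (s s' : ℝ≥0) :
    MemLp (fun ω ↦ c * (W s' ω - W s ω)) 2 P :=
  ((memLp_eval hW s').sub (memLp_eval hW s)).const_mul c

omit [IsProbabilityMeasure P] in
theorem memLp_integral (hW : IsPreBrownianReal W P) (g : WienerStep) :
    MemLp (g.integral W) 2 P :=
  memLp_finsetSum _ fun j _ ↦ memLp_increment hW (g.value j) (g.node j) (g.node (j + 1))

theorem integral_integral (hW : IsPreBrownianReal W P) (g : WienerStep) :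
    ∫ ω, g.integral W ω ∂P = 0 := by
  unfold WienerStep.integral
  rw [integral_finsetSum _ fun j _ ↦ (memLp_increment hW _ _ _).integrable (by norm_num)]
  refine Finset.sum_eq_zero fun j _ ↦ ?_
  rw [integral_const_mul, integral_sub (hW.integrable_eval _) (hW.integrable_eval _),
    hW.integral_eval, hW.integral_eval, sub_zero, mul_zero]

/-- Itô isometry for step functions: by bilinearity both sides are the same double sum of values of
`min`. -/
theorem variance_integral (hW : IsPreBrownianReal W P) (hg : g.node g.n ≤ t) :
    Var[g.integral W; P] = ∫ s in Set.Ioc (0 : ℝ) t, g.toFun s * g.toFun s := by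
  rw [integral_toFun_mul_toFun hg, ← covariance_self (memLp_integral hW g).aemeasurable]
  unfold WienerStep.integral
  rw [covariance_fun_sum_fun_sum' (fun j _ ↦ memLp_increment hW _ _ _)
    (fun j _ ↦ memLp_increment hW _ _ _)]
  refine Finset.sum_congr rfl fun i _ ↦ Finset.sum_congr rfl fun j _ ↦ ?_
  rw [covariance_const_mul_left, covariance_const_mul_right,
    covariance_fun_sub_fun_sub (memLp_eval hW _) (memLp_eval hW _) (memLp_eval hW _)
      (memLp_eval hW _)]
  simp only [hW.covariance_eval]
  push_cast
  ring

theorem covariance_integral (hW : IsPreBrownianReal W P) (hg : g.node g.n ≤ t) {ρ : ℝ}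
    (hB : MemLp B 2 P) (hcov : ∀ s ≤ t, cov[W s, B; P] = ρ * s) :
    cov[g.integral W, B; P] = ρ * ∫ s in Set.Ioc (0 : ℝ) t, g.toFun s := by
  rw [integral_toFun hg]
  unfold WienerStep.integral
  rw [covariance_fun_sum_left' (fun j _ ↦ memLp_increment hW _ _ _) hB, Finset.mul_sum]
  refine Finset.sum_congr rfl fun j hj ↦ ?_
  rw [covariance_const_mul_left, covariance_fun_sub_left (memLp_eval hW _) (memLp_eval hW _) hB,
    hcov _ (node_le hg (Finset.mem_range.1 hj)), hcov _ (node_le hg (Finset.mem_range.1 hj).le)]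
  ring

/-- A real Gaussian law is fixed by its mean and variance. The extra summand `B` makes room for the
second Brownian motion of the two-factor model. -/
theorem hasLaw_integral_add (hW : IsPreBrownianReal W P) (hg : g.node g.n ≤ t) {ρ : ℝ}
    (hB : MemLp B 2 P) (hB0 : P[B] = 0) (hcov : ∀ s ≤ t, cov[W s, B; P] = ρ * s)
    (hgauss : HasGaussianLaw (fun ω ↦ g.integral W ω + B ω) P) :
    HasLaw (fun ω ↦ g.integral W ω + B ω)
      (gaussianReal 0 ((∫ s in Set.Ioc (0 : ℝ) t, g.toFun s * g.toFun s) +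
        2 * (ρ * ∫ s in Set.Ioc (0 : ℝ) t, g.toFun s) + Var[B; P]).toNNReal) P := by
  refine ⟨hgauss.aemeasurable, ?_⟩
  rw [hgauss.map_eq_gaussianReal, variance_fun_add (memLp_integral hW g) hB,
    variance_integral hW hg, covariance_integral hW hg hB hcov,
    integral_add ((memLp_integral hW g).integrable (by norm_num)) (hB.integrable (by norm_num)),
    integral_integral hW, hB0, add_zero]

end WienerStep

theorem ProbabilityTheory.IsGaussianProcess.hasGaussianLaw_linearCombination
    {Ω T ι : Type*} [MeasurableSpace Ω] {P : Measure Ω} {X : T → Ω → ℝ}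
    (hX : IsGaussianProcess X P) (s : Finset ι) (c : ι → ℝ) (f : ι → T) :
    HasGaussianLaw (fun ω ↦ ∑ i ∈ s, c i * X (f i) ω) P :=
  ((hX.comp_right f).smul c).hasGaussianLaw_fun_sum

theorem WienerStep.hasGaussianLaw_integral_add {Ω T : Type*} [MeasurableSpace Ω] {P : Measure Ω}
    {X : T → Ω → ℝ} (hX : IsGaussianProcess X P) (f : ℝ≥0 → T) (p : T) (c : ℝ) (g : WienerStep) :
    HasGaussianLaw (fun ω ↦ g.integral (fun s ↦ X (f s)) ω + c * X p ω) P := by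
  -- One linear combination of values of `X`: the right nodes, the left nodes with opposite sign,
  -- and the point `p`.
  have h := hX.hasGaussianLaw_linearCombination
    (((Finset.range g.n).disjSum (Finset.range g.n)).disjSum {()})
    (Sum.elim (Sum.elim g.value fun j ↦ -g.value j) fun _ ↦ c)
    (Sum.elim (Sum.elim (fun j ↦ f (g.node (j + 1))) fun j ↦ f (g.node j)) fun _ ↦ p)
  convert h using 2 with ω
  simp only [Finset.sum_disjSum, Sum.elim_inl, Sum.elim_inr, Finset.sum_singleton,
    WienerStep.integral, ← Finset.sum_add_distrib]
  congr 1
  exact Finset.sum_congr rfl fun j _ ↦ by ring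

/-! ### Wiener integrals -/

namespace IsWienerIntegral

variable {Ω : Type*} [MeasurableSpace Ω] {P : Measure Ω} [IsProbabilityMeasure P]
  {W : ℝ≥0 → Ω → ℝ} {B I : Ω → ℝ} {t : ℝ≥0} {f : ℝ → ℝ}

theorem hasLaw_add (hI : IsWienerIntegral P W t f I) (hW : IsPreBrownianReal W P) {ρ : ℝ}
    (hf : MemLp f 2 (volume.restrict (Set.Ioc (0 : ℝ) t)))
    (hB : MemLp B 2 P) (hB0 : P[B] = 0) (hcov : ∀ s ≤ t, cov[W s, B; P] = ρ * s)
    (hgauss : ∀ g : WienerStep, HasGaussianLaw (fun ω ↦ g.integral W ω + B ω) P) :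
    ∃ v : ℝ≥0, (v : ℝ) = (∫ s in Set.Ioc (0 : ℝ) t, f s * f s) +
        2 * (ρ * ∫ s in Set.Ioc (0 : ℝ) t, f s) + Var[B; P] ∧
      HasLaw (fun ω ↦ I ω + B ω) (gaussianReal 0 v) P := by
  obtain ⟨hm, g, hg, hgf, hgI⟩ := hI
  have hgf' : Tendsto (fun m ↦ eLpNorm ((g m).toFun - f) 2
    (volume.restrict (Set.Ioc (0 : ℝ) t))) atTop (𝓝 0) := hgf
  have h1 := tendsto_integral_mul_of_tendsto_eLpNorm (fun m ↦ (g m).memLp_toFun t)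
    (fun m ↦ (g m).memLp_toFun t) hf hf hgf' hgf'
  have h2 := tendsto_integral_mul_of_tendsto_eLpNorm (fun m ↦ (g m).memLp_toFun t)
    (fun _ ↦ memLp_const (1 : ℝ)) hf (memLp_const (1 : ℝ)) hgf' (by simp)
  simp only [mul_one] at h2
  have h3 := (h1.add ((h2.const_mul ρ).const_mul 2)).add_const (Var[B; P])
  have hlaw := fun m ↦ (g m).hasLaw_integral_add hW (hg m) hB hB0 hcov (hgauss (g m))
  have hnn : ∀ m, 0 ≤ (∫ s in Set.Ioc (0 : ℝ) t, (g m).toFun s * (g m).toFun s) +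
        2 * (ρ * ∫ s in Set.Ioc (0 : ℝ) t, (g m).toFun s) + Var[B; P] := fun m ↦ by
    rw [← WienerStep.variance_integral hW (hg m),
      ← WienerStep.covariance_integral hW (hg m) hB hcov,
      ← variance_fun_add (WienerStep.memLp_integral hW _) hB]
    exact variance_nonneg _ _
  -- The limiting variance is nonnegative as a limit of variances, which makes it a legitimate
  -- parameter of `gaussianReal`.
  have hnn' := ge_of_tendsto' h3 hnn
  refine ⟨⟨_, hnn'⟩, rfl, hasLaw_gaussianReal_of_tendsto_eLpNorm hlaw
    (hm.add hB.1) ?_ ?_⟩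
  · refine hgI.congr fun m ↦ ?_
    congr 1 with ω
    simp
  · simp only [Real.coe_toNNReal _ (hnn _)]
    exact h3

-- The integral is only given up to null sets, whereas independence is assumed for paths. Some
-- subsequence of the elementary integrals converges almost everywhere, and its `limsup` is a
-- measurable functional of the path.
omit [IsProbabilityMeasure P] in
theorem exists_ae_eq_comp (hI : IsWienerIntegral P W t f I) (hW : ∀ s, Measurable (W s)) :
    ∃ Φ : (ℝ≥0 → ℝ) → ℝ, Measurable Φ ∧ I =ᵐ[P] fun ω ↦ Φ (fun s ↦ W s ω) := by
  obtain ⟨hm, g, -, -, hgI⟩ := hI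
  have hmeas : ∀ m, Measurable ((g m).integral W) := fun m ↦ by
    unfold WienerStep.integral; fun_prop
  obtain ⟨ns, -, hns⟩ := (tendstoInMeasure_of_tendsto_eLpNorm (p := 2) (by simp)
    (fun m ↦ (hmeas m).aestronglyMeasurable) hm hgI).exists_seq_tendsto_ae
  refine ⟨fun w ↦ limsup (fun m ↦ (g (ns m)).integral (fun s w ↦ w s) w) atTop,
    Measurable.limsup fun m ↦ ?_, ?_⟩
  · unfold WienerStep.integral; fun_prop
  · filter_upwards [hns] with ω hω
    exact hω.limsup_eq.symm

end IsWienerIntegral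

/-! ### Independence -/

/-- The hypotheses say that the joint law is a threefold product measure, and product measures may
be permuted and reassociated. -/
theorem ProbabilityTheory.IndepFun.prodMk_of_indepFun_prodMk {Ω α β γ : Type*} [MeasurableSpace Ω]
    [MeasurableSpace α] [MeasurableSpace β] [MeasurableSpace γ] {P : Measure Ω}
    [IsProbabilityMeasure P] {X : Ω → α} {Y : Ω → β} {Z : Ω → γ}
    (hX : AEMeasurable X P) (hY : AEMeasurable Y P) (hZ : AEMeasurable Z P)
    (h : IndepFun X (fun ω ↦ (Y ω, Z ω)) P) (h' : IndepFun Y Z P) :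
    IndepFun Y (fun ω ↦ (X ω, Z ω)) P := by
  have := Measure.isProbabilityMeasure_map hX
  have := Measure.isProbabilityMeasure_map hY
  have := Measure.isProbabilityMeasure_map hZ
  have hXZ : IndepFun X Z P := h.comp measurable_id measurable_snd
  rw [indepFun_iff_map_prod_eq_prod_map_map hY (hX.prodMk hZ),
    (indepFun_iff_map_prod_eq_prod_map_map hX hZ).1 hXZ]
  have e1 := (indepFun_iff_map_prod_eq_prod_map_map hX (hY.prodMk hZ)).1 h
  rw [(indepFun_iff_map_prod_eq_prod_map_map hY hZ).1 h'] at e1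
  have hmp := (measurePreserving_prodAssoc (P.map Y) (P.map X) (P.map Z)).comp
    (((Measure.measurePreserving_swap (μ := P.map X) (ν := P.map Y)).prod
      (MeasurePreserving.id (P.map Z))).comp
      (measurePreserving_prodAssoc (P.map X) (P.map Y) (P.map Z)).symm)
  rw [← hmp.map_eq, ← e1, AEMeasurable.map_map_of_aemeasurable hmp.measurable.aemeasurable
    (hX.prodMk (hY.prodMk hZ))]
  rfl

theorem ProbabilityTheory.HasLaw.gaussianReal_add {Ω : Type*} [MeasurableSpace Ω] {P : Measure Ω}
    {X Y : Ω → ℝ} {m m' : ℝ} {v v' : ℝ≥0} (hX : HasLaw X (gaussianReal m v) P)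
    (hY : HasLaw Y (gaussianReal m' v') P) (h : IndepFun X Y P) :
    HasLaw (fun ω ↦ X ω + Y ω) (gaussianReal (m + m') (v + v')) P :=
  ⟨hX.aemeasurable.add hY.aemeasurable,
    gaussianReal_add_gaussianReal_of_indepFun h hX.map_eq hY.map_eq⟩

/-! ### Sums of independent Gaussian marks -/

/-- Induction on the index set by adding independent Gaussians. Nonnegative coefficients keep the
variance an expression in `ℝ≥0`. -/
theorem hasLaw_sum_mul_gaussianReal {Ω ι : Type*} [MeasurableSpace Ω] {P : Measure Ω}
    [IsProbabilityMeasure P] {Y : ι → Ω → ℝ} {m : ℝ} {v : ℝ≥0} (hm : ∀ i, Measurable (Y i))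
    (hY : ∀ i, HasLaw (Y i) (gaussianReal m v) P) (hind : iIndepFun Y P) (a : ι → ℝ≥0)
    (s : Finset ι) :
    HasLaw (fun ω ↦ ∑ i ∈ s, a i * Y i ω)
      (gaussianReal (∑ i ∈ s, a i * m) (∑ i ∈ s, a i ^ 2 * v)) P := by
  classical
  induction s using Finset.induction_on with
  | empty =>
    simp only [Finset.sum_empty, gaussianReal_zero_var]
    exact hasLaw_dirac_of_ae_eq (.of_forall fun _ ↦ rfl)
  | insert i s hi ih =>
    have h1 : HasLaw (fun ω ↦ a i * Y i ω) (gaussianReal (a i * m) (a i ^ 2 * v)) P := by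
      exact gaussianReal_const_mul (hY i) (a i : ℝ)
    have hind' : iIndepFun (fun i ω ↦ (a i : ℝ) * Y i ω) P :=
      hind.comp (fun i x ↦ (a i : ℝ) * x) fun i ↦ measurable_const_mul _
    have h2 := hind'.indepFun_finsetSum_of_notMem (fun j ↦ (hm j).const_mul _) hi
    simp only [Finset.sum_insert hi]
    refine h1.gaussianReal_add ih ?_
    convert h2.symm using 1
    ext ω
    simp

/-! ### Jump-diffusion mixtures -/

section JumpMixture

variable {Ω ι : Type*} [MeasurableSpace Ω] {P : Measure Ω} [IsProbabilityMeasure P]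
  [Countable ι] [MeasurableSpace ι] [MeasurableSingletonClass ι] {κ : Ω → ι} {C : Ω → ℝ}
  {D : ι → Ω → ℝ} {c : ℝ} {vC : ℝ≥0} {m : ι → ℝ} {w : ι → ℝ≥0}

omit [Countable ι] [MeasurableSingletonClass ι] in
theorem hasLaw_add_and_indepFun (hκ : Measurable κ) (hC : HasLaw C (gaussianReal c vC) P)
    (hD : ∀ i, HasLaw (D i) (gaussianReal (m i) (w i)) P)
    (hCD : ∀ i, IndepFun C (fun ω ↦ (κ ω, D i ω)) P) (hκD : ∀ i, IndepFun κ (D i) P) (i : ι) :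
    HasLaw (fun ω ↦ C ω + D i ω) (gaussianReal (c + m i) (vC + w i)) P ∧
      IndepFun κ (fun ω ↦ C ω + D i ω) P :=
  ⟨hC.gaussianReal_add (hD i) ((hCD i).comp measurable_id measurable_snd),
    (IndepFun.prodMk_of_indepFun_prodMk hC.aemeasurable hκ.aemeasurable (hD i).aemeasurable
      (hCD i) (hκD i)).comp measurable_id (measurable_fst.add measurable_snd)⟩

/-- The moment of `C` is a common factor of all terms, so only the jump series `hb` has to be
summed. -/
theorem integral_exp_add_mixture (hκ : Measurable κ) (hC : HasLaw C (gaussianReal c vC) P)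
    (hD : ∀ i, HasLaw (D i) (gaussianReal (m i) (w i)) P)
    (hCD : ∀ i, IndepFun C (fun ω ↦ (κ ω, D i ω)) P) (hκD : ∀ i, IndepFun κ (D i) P) {b : ℝ}
    (hb : HasSum (fun i ↦ P.real (κ ⁻¹' {i}) * Real.exp (m i + w i / 2)) b) :
    Integrable (fun ω ↦ Real.exp (C ω + D (κ ω) ω)) P ∧
      ∫ ω, Real.exp (C ω + D (κ ω) ω) ∂P = Real.exp (c + vC / 2) * b := by
  have h := hasLaw_add_and_indepFun hκ hC hD hCD hκD
  have hb' : HasSum (fun i ↦ P.real (κ ⁻¹' {i}) * Real.exp (c + m i + (vC + w i : ℝ≥0) / 2))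
      (Real.exp (c + vC / 2) * b) := by
    refine (hb.mul_left (Real.exp (c + vC / 2))).congr_fun fun i ↦ ?_
    rw [mul_left_comm, ← Real.exp_add]
    congr 2
    push_cast
    ring
  obtain ⟨h1, h2⟩ := integral_exp_mixture hκ (fun i ↦ (h i).1) (fun i ↦ (h i).2) hb'.summable
  exact ⟨h1, h2.unique hb'⟩

omit [IsProbabilityMeasure P] in
theorem integral_exp_jump_mixture (hκ : Measurable κ)
    (hD : ∀ i, HasLaw (D i) (gaussianReal (m i) (w i)) P) (hκD : ∀ i, IndepFun κ (D i) P) {b : ℝ}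
    (hb : HasSum (fun i ↦ P.real (κ ⁻¹' {i}) * Real.exp (m i + w i / 2)) b) :
    Integrable (fun ω ↦ Real.exp (D (κ ω) ω)) P ∧ ∫ ω, Real.exp (D (κ ω) ω) ∂P = b := by
  obtain ⟨h1, h2⟩ := integral_exp_mixture hκ hD hκD hb.summable
  exact ⟨h1, h2.unique hb⟩

theorem hasSum_optionPrices_add_mixture {K r q : ℝ} {T : ℝ≥0} {P₀ v : ι → ℝ} (hK : 0 < K)
    (hκ : Measurable κ) (hC : HasLaw C (gaussianReal c vC) P)
    (hD : ∀ i, HasLaw (D i) (gaussianReal (m i) (w i)) P)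
    (hCD : ∀ i, IndepFun C (fun ω ↦ (κ ω, D i ω)) P) (hκD : ∀ i, IndepFun κ (D i) P)
    (hvC : vC ≠ 0) (hv : ∀ i, v i = vC + w i)
    (hF : ∀ i, P₀ i * Real.exp ((r - q) * T) = Real.exp (c + m i + v i / 2))
    (hint : Integrable (fun ω ↦ Real.exp (C ω + D (κ ω) ω)) P) :
    HasSum (fun i ↦ P.real (κ ⁻¹' {i}) * bsCall (P₀ i) K r T (v i) q)
      (riskNeutralPrice P r T (callPayoff K fun ω ↦ Real.exp (C ω + D (κ ω) ω))) ∧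
    HasSum (fun i ↦ P.real (κ ⁻¹' {i}) * bsPut (P₀ i) K r T (v i) q)
      (riskNeutralPrice P r T (putPayoff K fun ω ↦ Real.exp (C ω + D (κ ω) ω))) := by
  have h := hasLaw_add_and_indepFun hκ hC hD hCD hκD
  have hv' : ∀ i, v i = (vC + w i : ℝ≥0) := fun i ↦ by rw [hv]; push_cast; rfl
  simp only [hv'] at hF ⊢
  exact hasSum_optionPrices_mixture (X := fun i ω ↦ C ω + D i ω) hK hκ (fun i ↦ (h i).1)
    (fun i ↦ (h i).2) (fun i ↦ by simp [hvC]) hF hint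

end JumpMixture

/-! ### Poisson weights -/

theorem hasSum_poissonWeight_mul_pow (α x : ℝ) :
    HasSum (fun n ↦ poissonWeight n α * x ^ n) (Real.exp (α * (x - 1))) := by
  have h := (NormedSpace.expSeries_div_hasSum_exp (α * x)).mul_left (Real.exp (-α))
  rw [← Real.exp_eq_exp_ℝ, ← Real.exp_add] at h
  rw [show -α + α * x = α * (x - 1) by ring] at h
  refine h.congr_fun fun n ↦ ?_
  simp only [poissonWeight, mul_pow]
  ring

namespace IsPoissonProcess

variable {Ω : Type*} [MeasurableSpace Ω] {P : Measure Ω} {N : ℝ≥0 → Ω → ℕ} {lam : ℝ≥0}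

theorem hasLaw_eval (h : IsPoissonProcess N lam P) (t : ℝ≥0) :
    HasLaw (N t) (poissonMeasure (lam * t)) P := by
  have h1 := h.law_increment 0 t zero_le
  rw [tsub_zero] at h1
  refine h1.congr ?_
  filter_upwards [h.zero] with ω hω
  simp [hω]

theorem real_fiber (h : IsPoissonProcess N lam P) (t : ℝ≥0) (n : ℕ) :
    P.real (N t ⁻¹' {n}) = poissonWeight n (lam * t) := by
  rw [← map_measureReal_apply (h.measurable t) (measurableSet_singleton n),
    (h.hasLaw_eval t).map_eq, poissonMeasure_real_singleton, poissonWeight]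
  push_cast
  rfl

theorem integrable_pow (h : IsPoissonProcess N lam P) (t : ℝ≥0) (x : ℝ) :
    Integrable (fun ω ↦ x ^ N t ω) P := by
  have h1 : Integrable (fun n : ℕ ↦ x ^ n) (poissonMeasure (lam * t)) := by
    rw [integrable_poissonMeasure_iff]
    refine (hasSum_poissonWeight_mul_pow ((lam * t : ℝ≥0) : ℝ) |x|).summable.congr fun n ↦ ?_
    rw [poissonWeight, norm_pow, Real.norm_eq_abs]
  rw [← (h.hasLaw_eval t).map_eq] at h1
  exact h1.comp_measurable (h.measurable t)

end IsPoissonProcess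

/-! ### The exponential kernel -/

section ExpKernel

variable {k : ℝ}

theorem integral_exp_kernel (hk : k ≠ 0) (t : ℝ≥0) :
    ∫ s in Set.Ioc (0 : ℝ) t, Real.exp (-k * (t - s)) = (1 - Real.exp (-k * t)) / k := by
  rw [← intervalIntegral.integral_of_le t.coe_nonneg,
    intervalIntegral.integral_eq_sub_of_hasDerivAt
      (f := fun s : ℝ ↦ Real.exp (-k * (t - s)) / k) (fun s _ ↦ ?_)
      (Continuous.intervalIntegrable (by fun_prop) _ _)]
  · simp [sub_div]
  · have h := ((((hasDerivAt_id s).const_sub (t : ℝ)).const_mul (-k)).exp).div_const k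
    refine h.congr_deriv ?_
    simp only [id]
    field_simp

theorem integral_exp_kernel_mul_self (hk : k ≠ 0) (t : ℝ≥0) :
    ∫ s in Set.Ioc (0 : ℝ) t, Real.exp (-k * (t - s)) * Real.exp (-k * (t - s)) =
      (1 - Real.exp (-2 * k * t)) / (2 * k) := by
  have h := integral_exp_kernel (k := 2 * k) (by simpa using hk) t
  rw [show -2 * k * t = -(2 * k) * t by ring, ← h]
  congr 1 with s
  rw [← Real.exp_add]
  ring_nf

theorem memLp_exp_kernel (hk : 0 < k) (t : ℝ≥0) :
    MemLp (fun s : ℝ ↦ Real.exp (-k * (t - s))) 2 (volume.restrict (Set.Ioc (0 : ℝ) t)) := by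
  refine MemLp.of_bound (by fun_prop) 1 ?_
  filter_upwards [ae_restrict_mem measurableSet_Ioc] with s hs
  rw [Real.norm_eq_abs, Real.abs_exp, Real.exp_le_one_iff]
  nlinarith [hs.2]

end ExpKernel

/-! ### Laws of the continuous parts -/

section ContinuousParts

variable {Ω : Type*} [MeasurableSpace Ω] {P : Measure Ω} [IsProbabilityMeasure P]
  {I : ℝ≥0 → Ω → ℝ} {T : ℝ≥0} {k : ℝ}

omit [IsProbabilityMeasure P] in
theorem hasLaw_const_add_const_mul {X : Ω → ℝ} {m c d : ℝ} {v : ℝ≥0}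
    (hX : HasLaw X (gaussianReal m v) P) :
    ∃ v' : ℝ≥0, (v' : ℝ) = d ^ 2 * v ∧
      HasLaw (fun ω ↦ c + d * X ω) (gaussianReal (d * m + c) v') P :=
  ⟨_, by simp, gaussianReal_const_add (gaussianReal_const_mul hX d) c⟩

theorem hasLaw_gouCont {W : ℝ≥0 → Ω → ℝ} (hW : IsPreBrownianReal W P) (hk : 0 < k)
    (hI : IsWienerIntegral P W T (fun s ↦ Real.exp (-k * (T - s))) (I T)) (u₀ σ : ℝ) :
    ∃ v : ℝ≥0, (v : ℝ) = σ ^ 2 / (2 * k) * (1 - Real.exp (-2 * k * T)) ∧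
      HasLaw (gouCont u₀ k σ I T) (gaussianReal (u₀ * Real.exp (-k * T)) v) P := by
  -- With a single factor there is no extra Brownian summand.
  obtain ⟨v, hv, hlaw⟩ := hI.hasLaw_add (B := 0) (ρ := 0) hW (memLp_exp_kernel hk T)
    MemLp.zero (by simp) (by simp) (fun g ↦ by
      simpa using WienerStep.hasGaussianLaw_integral_add hW.isGaussianProcess id 0 0 g)
  obtain ⟨v', hv', h⟩ := hasLaw_const_add_const_mul (c := u₀ * Real.exp (-k * T)) (d := σ) hlaw
  refine ⟨v', ?_, ?_⟩
  · rw [hv', hv, integral_exp_kernel_mul_self hk.ne']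
    simp
    ring
  · convert h using 2
    · simp [gouCont]
    · simp

theorem hasLaw_ssCont {W : Fin 2 → ℝ≥0 → Ω → ℝ} {ρ σ₁ : ℝ} (hW : ∀ i, IsPreBrownianReal (W i) P)
    (hgauss : IsGaussianProcess (fun p : Fin 2 × ℝ≥0 ↦ W p.1 p.2) P)
    (hcov : ∀ s t : ℝ≥0, cov[W 0 s, W 1 t; P] = ρ * ((min s t : ℝ≥0) : ℝ)) (hk : 0 < k)
    (hI : IsWienerIntegral P (W 0) T (fun s ↦ Real.exp (-k * (T - s))) (I T)) (hσ₁ : σ₁ ≠ 0)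
    (u₁ u₂ μ σ₂ : ℝ) :
    ∃ v : ℝ≥0, (v : ℝ) = ssVarCont k σ₁ σ₂ ρ T ∧
      HasLaw (ssCont u₁ u₂ k μ σ₁ σ₂ I W T)
        (gaussianReal (u₁ * Real.exp (-k * T) + u₂ + μ * T) v) P := by
  have hm : MemLp (W 1 T) 2 P := WienerStep.memLp_eval (hW 1) T
  -- Factoring out `σ₁` leaves the integral with coefficient one, so the Brownian term and its
  -- covariance carry `σ₂ / σ₁`.
  obtain ⟨v, hv, hlaw⟩ := hI.hasLaw_add (B := fun ω ↦ σ₂ / σ₁ * W 1 T ω) (ρ := σ₂ / σ₁ * ρ)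
    (hW 0) (memLp_exp_kernel hk T) (hm.const_mul _)
    (by rw [integral_const_mul, (hW 1).integral_eval, mul_zero])
    (fun s hs ↦ by rw [covariance_const_mul_right, hcov, min_eq_left hs, mul_assoc])
    (fun g ↦ WienerStep.hasGaussianLaw_integral_add hgauss (fun s ↦ (0, s)) (1, T) (σ₂ / σ₁) g)
  obtain ⟨v', hv', h⟩ := hasLaw_const_add_const_mul
    (c := u₁ * Real.exp (-k * T) + u₂ + μ * T) (d := σ₁) hlaw
  have hVar : Var[W 1 T; P] = T := by
    rw [((hW 1).hasLaw_eval T).variance_eq, variance_id_gaussianReal]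
  refine ⟨v', ?_, ?_⟩
  · rw [hv', hv, integral_exp_kernel_mul_self hk.ne', integral_exp_kernel hk.ne',
      variance_const_mul, hVar, ssVarCont]
    field_simp
    ring
  · convert h using 2
    · simp only [ssCont, gouCont]
      field_simp
      ring
    · simp

theorem gouVar_pos {σ : ℝ} (hk : 0 < k) (hσ : 0 < σ) (hT : 0 < T) :
    0 < σ ^ 2 / (2 * k) * (1 - Real.exp (-2 * k * T)) := by
  have hT' : (0 : ℝ) < T := hT
  have : Real.exp (-2 * k * T) < 1 := Real.exp_lt_one_iff.2 (by nlinarith [mul_pos hk hT'])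
  have := sub_pos.2 this
  positivity

/-- Equivalent to `tanh (x / 2) < x / 2`. The difference of the two sides vanishes at `0`, and its
derivative is positive because `1 + y < exp y`. -/
theorem two_mul_one_sub_exp_neg_lt {x : ℝ} (hx : 0 < x) :
    2 * (1 - Real.exp (-x)) < x * (1 + Real.exp (-x)) := by
  have hd : ∀ y, HasDerivAt (fun y ↦ y * (1 + Real.exp (-y)) - 2 * (1 - Real.exp (-y)))
      (1 - (1 + y) * Real.exp (-y)) y := fun y ↦ by
    have he := (hasDerivAt_neg y).exp
    refine (((hasDerivAt_id y).mul (he.const_add 1)).sub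
      ((he.const_sub 1).const_mul 2)).congr_deriv ?_
    simp only [id]
    ring
  have hmono : StrictMonoOn (fun y ↦ y * (1 + Real.exp (-y)) - 2 * (1 - Real.exp (-y)))
      (Set.Ici 0) := by
    refine strictMonoOn_of_deriv_pos (convex_Ici 0)
      (fun y _ ↦ (hd y).continuousAt.continuousWithinAt) fun y hy ↦ ?_
    rw [interior_Ici] at hy
    rw [(hd y).deriv, Real.exp_neg, sub_pos, ← div_eq_mul_inv, div_lt_one (Real.exp_pos y)]
    linarith [Real.add_one_lt_exp (ne_of_gt hy)]
  have := hmono Set.self_mem_Ici hx.le hx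
  simp at this
  linarith

/-- The critical case is `ρ = -1`, where the variance is the squared `L²` norm of `σ₁ exp(-k(T - s))
- σ₂`; the kernel is not constant, so this cannot vanish. -/
theorem ssVarCont_pos {ρ σ₁ σ₂ : ℝ} (hρ : ρ ∈ Set.Icc (-1 : ℝ) 1) (hk : 0 < k) (hσ₁ : 0 < σ₁)
    (hσ₂ : 0 < σ₂) (hT : 0 < T) : 0 < ssVarCont k σ₁ σ₂ ρ T := by
  have hT' : (0 : ℝ) < T := hT
  have hx := mul_pos hk hT'
  have h1 := two_mul_one_sub_exp_neg_lt hx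
  have he : Real.exp (-(k * T)) < 1 := Real.exp_lt_one_iff.2 (by linarith)
  have he0 := Real.exp_pos (-(k * T))
  have h2 : ssVarCont k σ₁ σ₂ ρ T * (2 * k) =
      σ₁ ^ 2 * (1 - Real.exp (-(k * T)) ^ 2) + 2 * σ₂ ^ 2 * (k * T) +
        4 * ρ * σ₁ * σ₂ * (1 - Real.exp (-(k * T))) := by
    rw [ssVarCont, show -2 * k * (T : ℝ) = -(k * T) + -(k * T) by ring, Real.exp_add,
      show -k * (T : ℝ) = -(k * T) by ring]
    field_simp
    ring
  set e := Real.exp (-(k * T))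
  set x := k * (T : ℝ)
  -- After multiplication by `1 + e` the expression is exactly the sum of a completed square `hA`,
  -- the strictly positive gap `hB` from `h1`, and the excess `hC` of `ρ` over `-1`.
  have h3 : 0 < ssVarCont k σ₁ σ₂ ρ T * (2 * k) * (1 + e) := by
    have hs := mul_pos hσ₁ hσ₂
    have hA : 0 ≤ (1 - e) * (σ₁ * (1 + e) - 2 * σ₂) ^ 2 :=
      mul_nonneg (by linarith) (sq_nonneg _)
    have hB : 0 < 2 * σ₂ ^ 2 * (x * (1 + e) - 2 * (1 - e)) :=
      mul_pos (by positivity) (by linarith)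
    have hC : 0 ≤ 4 * (1 + ρ) * (σ₁ * σ₂) * ((1 - e) * (1 + e)) :=
      mul_nonneg (mul_nonneg (by linarith [hρ.1]) hs.le)
        (mul_nonneg (by linarith) (by linarith))
    rw [h2]
    linarith
  exact pos_of_mul_pos_left (pos_of_mul_pos_left h3 (by linarith)) (by linarith)

end ContinuousParts

/-! ### Spot prices with a forward curve -/

section ForwardSpot

variable {Ω : Type*} [MeasurableSpace Ω] {P : Measure Ω}

omit [MeasurableSpace Ω] in
theorem forwardSpot_eq_exp {F h : ℝ≥0 → ℝ} {U : ℝ≥0 → Ω → ℝ} {T : ℝ≥0} (hF : 0 < F T) :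
    forwardSpot F h U T = fun ω ↦ Real.exp (Real.log (F T) + h T + U T ω) := by
  ext ω
  rw [forwardSpot, add_assoc, Real.exp_add _ (h T + U T ω), Real.exp_log hF, add_comm]

theorem integrable_forwardSpot {F h : ℝ≥0 → ℝ} {U : ℝ≥0 → Ω → ℝ} {T : ℝ≥0}
    (hU : Integrable (fun ω ↦ Real.exp (U T ω)) P) : Integrable (forwardSpot F h U T) P := by
  have : forwardSpot F h U T = fun ω ↦ F T * Real.exp (h T) * Real.exp (U T ω) := by
    ext ω
    rw [forwardSpot, Real.exp_add]
    ring
  rw [this]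
  exact hU.const_mul _

theorem integral_forwardSpot_eq_iff {F h : ℝ≥0 → ℝ} {U : ℝ≥0 → Ω → ℝ} {T : ℝ≥0} {a b : ℝ}
    (hF : 0 < F T) (hU : ∫ ω, Real.exp (U T ω) ∂P = Real.exp a * Real.exp b) :
    P[forwardSpot F h U T] = F T ↔ h T = -a - b := by
  have : ∀ ω, forwardSpot F h U T ω = F T * Real.exp (h T) * Real.exp (U T ω) := by
    intro ω
    rw [forwardSpot, Real.exp_add]
    ring
  simp_rw [this]
  rw [integral_const_mul, hU, mul_assoc, ← Real.exp_add, ← Real.exp_add,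
    mul_eq_left₀ hF.ne', Real.exp_eq_one_iff]
  constructor <;> intro h <;> linarith

end ForwardSpot

/-! ### Single-asset jump parts -/

namespace IsAssetDriver

variable {Ω : Type*} [MeasurableSpace Ω] {P : Measure Ω} [IsProbabilityMeasure P]
  {W : ℝ≥0 → Ω → ℝ} {N : ℝ≥0 → Ω → ℕ} {Y : ℕ → Ω → ℝ} {lam : ℝ≥0} {m : ℝ} {v : ℝ≥0}

/-- The parameters `a` and `d` serve both single-asset models: `a = exp(-kT)`, `d = 0` for
Ornstein-Uhlenbeck, and `a = ν`, `d = log M - ν²/2` for Merton. -/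
theorem hasLaw_sum (hA : IsAssetDriver P W N Y lam m v) (a : ℝ≥0) (d : ℝ) (n : ℕ) :
    HasLaw (fun ω ↦ n * d + ∑ j ∈ Finset.range n, a * Y j ω)
      (gaussianReal (n * (d + a * m)) (n * (a ^ 2 * v))) P := by
  have h := gaussianReal_const_add (hasLaw_sum_mul_gaussianReal hA.measurable_Y hA.law_mark
    hA.iIndep_mark (fun _ ↦ a) (Finset.range n)) (n * d)
  convert h using 2
  · simp
    ring
  · simp

omit [IsProbabilityMeasure P] in
theorem indepFun_count_sum (hA : IsAssetDriver P W N Y lam m v) (a : ℝ≥0) (d : ℝ) (T : ℝ≥0)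
    (n : ℕ) :
    IndepFun (N T) (fun ω ↦ n * d + ∑ j ∈ Finset.range n, a * Y j ω) P :=
  hA.indep_N.comp (show Measurable fun x : ℝ≥0 → ℕ ↦ x T by fun_prop)
    (show Measurable fun y : ℕ → ℝ ↦ n * d + ∑ j ∈ Finset.range n, a * y j by fun_prop)

omit [IsProbabilityMeasure P] in
theorem indepFun_count_sum_prodMk (hA : IsAssetDriver P W N Y lam m v) (a : ℝ≥0) (d : ℝ) (T : ℝ≥0)
    (n : ℕ) {C : Ω → ℝ} {Φ : (ℝ≥0 → ℝ) → ℝ} (hΦ : Measurable Φ)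
    (hC : C =ᵐ[P] fun ω ↦ Φ (fun s ↦ W s ω)) :
    IndepFun C (fun ω ↦ (N T ω, n * d + ∑ j ∈ Finset.range n, a * Y j ω)) P :=
  (hA.indep_W.comp hΦ (show Measurable fun p : (ℝ≥0 → ℕ) × (ℕ → ℝ) ↦
    (p.1 T, n * d + ∑ j ∈ Finset.range n, a * p.2 j) by fun_prop)).congr hC.symm (ae_eq_refl _)

-- Each jump multiplies the exponential moment by the same factor, so the series is the Poisson
-- generating function at that factor.
omit [IsProbabilityMeasure P] in
theorem hasSum_exp_sum (hA : IsAssetDriver P W N Y lam m v) (a : ℝ≥0) (d : ℝ) (T : ℝ≥0) :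
    HasSum (fun n ↦ P.real (N T ⁻¹' {n}) *
        Real.exp (n * (d + a * m) + (n * (a ^ 2 * v) : ℝ≥0) / 2))
      (Real.exp (lam * T * (Real.exp (d + a * (m + 1 / 2 * a * v)) - 1))) := by
  refine (hasSum_poissonWeight_mul_pow (lam * T) _).congr_fun fun n ↦ ?_
  rw [hA.poisson.real_fiber, ← Real.exp_nat_mul]
  push_cast
  ring_nf

end IsAssetDriver

/-! ### Geometric Ornstein-Uhlenbeck process plus jumps -/

section GeometricOU

variable {Ω : Type*} [MeasurableSpace Ω] {P : Measure Ω} [IsProbabilityMeasure P]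
  {W : ℝ≥0 → Ω → ℝ} {N : ℝ≥0 → Ω → ℕ} {Y : ℕ → Ω → ℝ} {I : ℝ≥0 → Ω → ℝ} {lam ν : ℝ≥0}
  {M u₀ k σ : ℝ} {F h : ℝ≥0 → ℝ}

omit [MeasurableSpace Ω] in
theorem gouJump_eq (k : ℝ) (N : ℝ≥0 → Ω → ℕ) (Y : ℕ → Ω → ℝ) (T : ℝ≥0) (ω : Ω) :
    gouJump k N Y T ω = N T ω * 0 +
      ∑ j ∈ Finset.range (N T ω), (Real.exp (-k * T)).toNNReal * Y j ω := by
  simp [gouJump, compoundSum, Finset.mul_sum, Real.coe_toNNReal _ (Real.exp_pos _).le]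

omit [IsProbabilityMeasure P] in
theorem exists_ae_eq_gouCont (hW : ∀ t, Measurable (W t)) {T : ℝ≥0}
    (hI : IsWienerIntegral P W T (fun s ↦ Real.exp (-k * (T - s))) (I T)) (u₀ σ c : ℝ) :
    ∃ Φ : (ℝ≥0 → ℝ) → ℝ, Measurable Φ ∧
      (fun ω ↦ c + gouCont u₀ k σ I T ω) =ᵐ[P] fun ω ↦ Φ (fun s ↦ W s ω) := by
  obtain ⟨Φ, hΦ, h⟩ := hI.exists_ae_eq_comp hW
  refine ⟨fun w ↦ c + (u₀ * Real.exp (-k * T) + σ * Φ w), by fun_prop, ?_⟩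
  filter_upwards [h] with ω hω
  rw [gouCont, hω]

theorem gou_moments (hA : IsAssetDriver P W N Y lam M (ν ^ 2)) (hk : 0 < k) (hF : ∀ t, 0 < F t)
    (hI : ∀ t : ℝ≥0, IsWienerIntegral P W t (fun s ↦ Real.exp (-k * (t - s))) (I t)) (T : ℝ≥0) :
    P[gouCont u₀ k σ I T] = u₀ * Real.exp (-k * T) ∧
    Var[gouCont u₀ k σ I T; P] = σ ^ 2 / (2 * k) * (1 - Real.exp (-2 * k * T)) ∧
    Integrable (fun ω ↦ Real.exp (gouCont u₀ k σ I T ω)) P ∧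
    ∫ ω, Real.exp (gouCont u₀ k σ I T ω) ∂P = Real.exp (gouA u₀ k σ T) ∧
    Integrable (fun ω ↦ Real.exp (gouJump k N Y T ω)) P ∧
    ∫ ω, Real.exp (gouJump k N Y T ω) ∂P = Real.exp (gouB k lam M ν T) ∧
    Integrable (forwardSpot F h (fun t ω ↦ gouCont u₀ k σ I t ω + gouJump k N Y t ω) T) P ∧
    (P[forwardSpot F h (fun t ω ↦ gouCont u₀ k σ I t ω + gouJump k N Y t ω) T] = F T ↔
      h T = -gouA u₀ k σ T - gouB k lam M ν T) := by
  obtain ⟨v, hv, hC⟩ := hasLaw_gouCont hA.brownian.toIsPreBrownianReal hk (hI T) u₀ σ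
  obtain ⟨Φ, hΦ, hae⟩ := exists_ae_eq_gouCont hA.measurable_W (hI T) u₀ σ 0
  simp only [zero_add] at hae
  set a := (Real.exp (-k * T)).toNNReal with ha
  have ha' : (a : ℝ) = Real.exp (-k * T) := Real.coe_toNNReal _ (Real.exp_pos _).le
  have hb := hA.hasSum_exp_sum a 0 T
  have hgA : Real.exp (u₀ * Real.exp (-k * T) + v / 2) = Real.exp (gouA u₀ k σ T) := by
    rw [hv, gouA]
    ring_nf
  have hgB : Real.exp (lam * T * (Real.exp (0 + a * (M + 1 / 2 * a * (ν ^ 2 : ℝ≥0))) - 1)) =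
      Real.exp (gouB k lam M ν T) := by
    rw [gouB, ha', zero_add]
    push_cast
    rfl
  rw [hgB] at hb
  obtain ⟨d1, d2⟩ := integral_exp_jump_mixture (hA.poisson.measurable T) (hA.hasLaw_sum a 0)
    (hA.indepFun_count_sum a 0 T) hb
  obtain ⟨s1, s2⟩ := integral_exp_add_mixture (hA.poisson.measurable T) hC (hA.hasLaw_sum a 0)
    (fun n ↦ hA.indepFun_count_sum_prodMk a 0 T n hΦ hae) (hA.indepFun_count_sum a 0 T) hb
  simp only [ha, ← gouJump_eq] at d1 d2 s1 s2
  rw [hgA] at s2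
  obtain ⟨c1, c2⟩ := integral_exp_of_hasLaw hC
  rw [hgA] at c2
  refine ⟨?_, ?_, c1, c2, d1, d2, integrable_forwardSpot s1, integral_forwardSpot_eq_iff (hF T) s2⟩
  · rw [hC.integral_eq, integral_id_gaussianReal]
  · rw [hC.variance_eq, variance_id_gaussianReal, hv]

theorem gou_optionPrices (hA : IsAssetDriver P W N Y lam M (ν ^ 2)) (hk : 0 < k) (hσ : 0 < σ)
    (hF : ∀ t, 0 < F t)
    (hI : ∀ t : ℝ≥0, IsWienerIntegral P W t (fun s ↦ Real.exp (-k * (t - s))) (I t))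
    {S : ℝ≥0 → Ω → ℝ}
    (hS : S = forwardSpot F h (fun t ω ↦ gouCont u₀ k σ I t ω + gouJump k N Y t ω))
    {T : ℝ≥0} {r K : ℝ} (hT : 0 < T) (hK : 0 < K) (hST : P[S T] = F T) :
    Integrable (callPayoff K (S T)) P ∧
    HasSum (fun n : ℕ ↦ poissonWeight n (lam * T) *
        bsCall (F T * Real.exp (gouP k lam M ν n T)) K r T
          (Var[gouCont u₀ k σ I T; P] + n * Real.exp (-2 * k * T) * (ν : ℝ) ^ 2) r)
      (riskNeutralPrice P r T (callPayoff K (S T))) ∧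
    HasSum (fun n : ℕ ↦ poissonWeight n (lam * T) *
        bsPut (F T * Real.exp (gouP k lam M ν n T)) K r T
          (Var[gouCont u₀ k σ I T; P] + n * Real.exp (-2 * k * T) * (ν : ℝ) ^ 2) r)
      (riskNeutralPrice P r T (putPayoff K (S T))) := by
  obtain ⟨-, hVar, -, -, -, -, hint, hiff⟩ := gou_moments (h := h) (u₀ := u₀) (σ := σ) hA hk hF hI T
  obtain ⟨v, hv, hC⟩ := hasLaw_gouCont hA.brownian.toIsPreBrownianReal hk (hI T) u₀ σ
  obtain ⟨Φ, hΦ, hae⟩ := exists_ae_eq_gouCont hA.measurable_W (hI T) u₀ σ (Real.log (F T) + h T)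
  -- Positivity of `σ` and `T` rules out a degenerate law, also when no jump occurs or `ν = 0`.
  have hv0 : v ≠ 0 := by
    rintro rfl
    exact (gouVar_pos hk hσ hT).ne hv
  set a := (Real.exp (-k * T)).toNNReal with ha
  have ha' : (a : ℝ) = Real.exp (-k * T) := Real.coe_toNNReal _ (Real.exp_pos _).le
  have he2 : Real.exp (-2 * k * T) = (a : ℝ) ^ 2 := by
    rw [ha', sq, ← Real.exp_add]
    ring_nf
  have hhT := hiff.1 (hS ▸ hST)
  have hSexp : S T = fun ω ↦ Real.exp (Real.log (F T) + h T + gouCont u₀ k σ I T ω +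
      (N T ω * 0 + ∑ j ∈ Finset.range (N T ω), a * Y j ω)) := by
    rw [hS, forwardSpot_eq_exp (hF T)]
    simp only [ha, ← gouJump_eq, add_assoc]
  rw [← hS, hSexp] at hint
  -- With `q = r` the growth factor `exp((r - q)T)` is one, so the starting value is itself the
  -- forward price. The constant `log (F T) + h T` is absorbed into the Gaussian part.
  obtain ⟨p1, p2⟩ := hasSum_optionPrices_add_mixture (r := r) (q := r) (T := T)
    (P₀ := fun n : ℕ ↦ F T * Real.exp (gouP k lam M ν n T))
    (v := fun n : ℕ ↦ Var[gouCont u₀ k σ I T; P] + n * Real.exp (-2 * k * T) * (ν : ℝ) ^ 2)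
    hK (hA.poisson.measurable T) (gaussianReal_const_add hC (Real.log (F T) + h T))
    (hA.hasLaw_sum a 0) (fun n ↦ hA.indepFun_count_sum_prodMk a 0 T n hΦ hae)
    (hA.indepFun_count_sum a 0 T) hv0 (fun n ↦ by
      rw [hVar, hv, he2]
      push_cast
      ring) (fun n ↦ by
      rw [sub_self, zero_mul, Real.exp_zero, mul_one, ← Real.exp_log (hF T), ← Real.exp_add,
        Real.exp_log (hF T), hhT, hVar, gouA, gouP, ← ha', he2]
      ring_nf) hint
  simp only [hA.poisson.real_fiber] at p1 p2
  rw [hSexp]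
  exact ⟨integrable_call_of_integrable K hint, p1, p2⟩

end GeometricOU

/-! ### Geometric Brownian motion plus jumps -/

section GeometricBM

variable {Ω : Type*} [MeasurableSpace Ω] {P : Measure Ω} [IsProbabilityMeasure P]
  {W : ℝ≥0 → Ω → ℝ} {N : ℝ≥0 → Ω → ℕ} {Z : ℕ → Ω → ℝ} {lam ν : ℝ≥0} {S₀ μ σ M r : ℝ}

omit [IsProbabilityMeasure P] in
theorem integral_gbmJump {X : Ω → ℝ} (hX : HasLaw X (gaussianReal 0 1) P) (M : ℝ) (ν : ℝ≥0) :
    Integrable (fun ω ↦ M * Real.exp (-(ν : ℝ) ^ 2 / 2 + ν * X ω)) P ∧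
      ∫ ω, M * Real.exp (-(ν : ℝ) ^ 2 / 2 + ν * X ω) ∂P = M := by
  obtain ⟨v, hv, h⟩ := hasLaw_const_add_const_mul (c := -(ν : ℝ) ^ 2 / 2) (d := ν) hX
  obtain ⟨h1, h2⟩ := integral_exp_of_hasLaw h
  refine ⟨h1.const_mul M, ?_⟩
  rw [integral_const_mul, h2, hv]
  simp
  ring_nf
  simp

omit [MeasurableSpace Ω] in
theorem gbmSpot_eq_exp (hM : 0 < M) (T : ℝ≥0) :
    gbmSpot S₀ μ σ M ν W N Z T = fun ω ↦
      Real.exp (Real.log S₀ + (μ - σ ^ 2 / 2) * T + σ * W T ω +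
        (N T ω * (Real.log M - (ν : ℝ) ^ 2 / 2) + ∑ j ∈ Finset.range (N T ω), ν * Z j ω)) := by
  ext ω
  have : ∀ j, Real.log (gbmJump M ν Z j ω) = Real.log M - (ν : ℝ) ^ 2 / 2 + ν * Z j ω := fun j ↦ by
    rw [gbmJump, Real.log_mul hM.ne' (Real.exp_pos _).ne', Real.log_exp]
    ring
  simp [gbmSpot, compoundSum, this, Finset.sum_add_distrib, mul_sub]

theorem integral_gbmSpot (hA : IsAssetDriver P W N Z lam 0 1) (hS₀ : 0 < S₀) (hM : 0 < M)
    (T : ℝ≥0) :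
    Integrable (gbmSpot S₀ μ σ M ν W N Z T) P ∧
      P[gbmSpot S₀ μ σ M ν W N Z T] = S₀ * Real.exp (μ * T + lam * T * (M - 1)) := by
  obtain ⟨v, hv, hC⟩ := hasLaw_const_add_const_mul (c := Real.log S₀ + (μ - σ ^ 2 / 2) * T) (d := σ)
    (hA.brownian.hasLaw_eval T)
  have hb := hA.hasSum_exp_sum ν (Real.log M - (ν : ℝ) ^ 2 / 2) T
  obtain ⟨s1, s2⟩ := integral_exp_add_mixture (hA.poisson.measurable T) hC
    (hA.hasLaw_sum ν (Real.log M - (ν : ℝ) ^ 2 / 2))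
    (fun n ↦ hA.indepFun_count_sum_prodMk ν _ T n
      (Φ := fun w ↦ Real.log S₀ + (μ - σ ^ 2 / 2) * T + σ * w T) (by fun_prop) (ae_eq_refl _))
    (hA.indepFun_count_sum ν _ T) hb
  rw [gbmSpot_eq_exp hM]
  refine ⟨s1, s2.trans ?_⟩
  -- The correction `-ν²/2` cancels the Gaussian convexity term: one jump contributes the factor `M`
  -- in mean.
  have : Real.log M - (ν : ℝ) ^ 2 / 2 + ν * (0 + 1 / 2 * ν * (1 : ℝ≥0)) = Real.log M := by
    push_cast
    ring
  rw [this, Real.exp_log hM, ← Real.exp_add, hv]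
  rw [← Real.exp_log hS₀, ← Real.exp_add, Real.exp_log hS₀]
  ring_nf

theorem integral_gbmSpot_eq_iff (hA : IsAssetDriver P W N Z lam 0 1) (hS₀ : 0 < S₀) (hM : 0 < M)
    {T : ℝ≥0} (hT : 0 < T) :
    P[gbmSpot S₀ μ σ M ν W N Z T] = S₀ * Real.exp (r * T) ↔ μ - r = -lam * (M - 1) := by
  have hT' : (T : ℝ) ≠ 0 := by exact_mod_cast hT.ne'
  rw [(integral_gbmSpot hA hS₀ hM T).2, mul_right_inj' hS₀.ne', Real.exp_eq_exp,
    show μ * T + lam * T * (M - 1) = (μ + lam * (M - 1)) * T by ring, mul_left_inj' hT']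
  constructor <;> intro h <;> linarith

theorem gbm_optionPrices (hA : IsAssetDriver P W N Z lam 0 1) (hS₀ : 0 < S₀) (hσ : 0 < σ)
    (hM : 0 < M) {T : ℝ≥0} {K : ℝ} (hT : 0 < T) (hK : 0 < K) (hμ : μ - r = -lam * (M - 1)) :
    HasSum (fun n : ℕ ↦ poissonWeight n (lam * T) *
        bsCall (gbmStart S₀ M lam T n) K r T (gbmVar σ ν T n) 0)
      (riskNeutralPrice P r T (callPayoff K (gbmSpot S₀ μ σ M ν W N Z T))) ∧
    HasSum (fun n : ℕ ↦ poissonWeight n (lam * T) *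
        bsPut (gbmStart S₀ M lam T n) K r T (gbmVar σ ν T n) 0)
      (riskNeutralPrice P r T (putPayoff K (gbmSpot S₀ μ σ M ν W N Z T))) := by
  obtain ⟨v, hv, hC⟩ := hasLaw_const_add_const_mul (c := Real.log S₀ + (μ - σ ^ 2 / 2) * T) (d := σ)
    (hA.brownian.hasLaw_eval T)
  have hint := (integral_gbmSpot (μ := μ) (σ := σ) (ν := ν) hA hS₀ hM T).1
  rw [gbmSpot_eq_exp hM] at hint ⊢
  have hv0 : v ≠ 0 := by
    rintro rfl
    have : (0 : ℝ) < T := hT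
    exact (by positivity : (0 : ℝ) < σ ^ 2 * T).ne hv
  obtain ⟨p1, p2⟩ := hasSum_optionPrices_add_mixture (r := r) (q := 0) (T := T)
    (P₀ := fun n : ℕ ↦ gbmStart S₀ M lam T n) (v := fun n : ℕ ↦ gbmVar σ ν T n)
    hK (hA.poisson.measurable T) hC (hA.hasLaw_sum ν (Real.log M - (ν : ℝ) ^ 2 / 2))
    (fun n ↦ hA.indepFun_count_sum_prodMk ν _ T n
      (Φ := fun w ↦ Real.log S₀ + (μ - σ ^ 2 / 2) * T + σ * w T) (by fun_prop) (ae_eq_refl _))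
    (hA.indepFun_count_sum ν _ T) hv0 (fun n ↦ by
      rw [gbmVar, hv]
      push_cast
      ring) (fun n ↦ by
      -- The compensated drift `μ = r - λ(M - 1)` is what produces the factor `exp(λT(1 - M))` of
      -- the starting value.
      rw [gbmStart, gbmVar]
      nth_rw 1 [← Real.exp_log hS₀, ← Real.exp_log hM]
      rw [← Real.exp_nat_mul, ← Real.exp_add, ← Real.exp_add, ← Real.exp_add,
        show μ = r + -lam * (M - 1) by linarith]
      ring_nf) hint
  simp only [hA.poisson.real_fiber] at p1 p2
  exact ⟨p1, p2⟩

end GeometricBM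

/-! ### Two-factor jump parts -/

namespace IsTwoFactorDriver

variable {Ω : Type*} [MeasurableSpace Ω] {P : Measure Ω} [IsProbabilityMeasure P]
  {W : Fin 2 → ℝ≥0 → Ω → ℝ} {N : Fin 2 → ℝ≥0 → Ω → ℕ} {Y : Fin 2 → ℕ → Ω → ℝ}
  {ρ : ℝ} {lam : Fin 2 → ℝ≥0} {m : ℝ} {v : ℝ≥0}

theorem hasLaw_sum (hA : IsTwoFactorDriver P W N Y ρ lam m v) (a : ℝ≥0) (n : ℕ × ℕ) :
    HasLaw (fun ω ↦ ∑ j ∈ Finset.range n.1, a * Y 0 j ω + ∑ j ∈ Finset.range n.2, Y 1 j ω)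
      (gaussianReal (n.1 * (a * m) + n.2 * m) (n.1 * (a ^ 2 * v) + n.2 * v)) P := by
  -- The two mark sequences are merged into one i.i.d. family indexed by `ℕ ⊕ ℕ`, with weight `a` on
  -- the first and `1` on the second.
  have hinj : Function.Injective
      (Sum.elim (fun j ↦ ((0 : Fin 2), j)) fun j ↦ (1, j) : ℕ ⊕ ℕ → Fin 2 × ℕ) := by
    rintro (i | i) (j | j) h <;> simp_all
  have hind := hA.iIndep_mark.precomp hinj
  have h := hasLaw_sum_mul_gaussianReal (fun _ ↦ hA.measurable_Y _ _) (fun _ ↦ hA.law_mark _ _)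
    hind (Sum.elim (fun _ ↦ a) fun _ ↦ 1) ((Finset.range n.1).disjSum (Finset.range n.2))
  simpa [Finset.sum_disjSum] using h

omit [IsProbabilityMeasure P] in
theorem indepFun_count_sum (hA : IsTwoFactorDriver P W N Y ρ lam m v) (a : ℝ≥0) (T : ℝ≥0)
    (n : ℕ × ℕ) :
    IndepFun (fun ω ↦ (N 0 T ω, N 1 T ω))
      (fun ω ↦ ∑ j ∈ Finset.range n.1, a * Y 0 j ω + ∑ j ∈ Finset.range n.2, Y 1 j ω) P :=
  hA.indep_N.comp (show Measurable fun x : Fin 2 → ℝ≥0 → ℕ ↦ (x 0 T, x 1 T) by fun_prop)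
    (show Measurable fun y : Fin 2 → ℕ → ℝ ↦
      ∑ j ∈ Finset.range n.1, a * y 0 j + ∑ j ∈ Finset.range n.2, y 1 j by fun_prop)

omit [IsProbabilityMeasure P] in
theorem indepFun_count_sum_prodMk (hA : IsTwoFactorDriver P W N Y ρ lam m v) (a : ℝ≥0) (T : ℝ≥0)
    (n : ℕ × ℕ) {C : Ω → ℝ} {Φ : (Fin 2 → ℝ≥0 → ℝ) → ℝ} (hΦ : Measurable Φ)
    (hC : C =ᵐ[P] fun ω ↦ Φ (fun i s ↦ W i s ω)) :
    IndepFun C (fun ω ↦ ((N 0 T ω, N 1 T ω),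
      ∑ j ∈ Finset.range n.1, a * Y 0 j ω + ∑ j ∈ Finset.range n.2, Y 1 j ω)) P :=
  (hA.indep_W.comp hΦ (show Measurable fun p : (Fin 2 → ℝ≥0 → ℕ) × (Fin 2 → ℕ → ℝ) ↦
    ((p.1 0 T, p.1 1 T),
      ∑ j ∈ Finset.range n.1, a * p.2 0 j + ∑ j ∈ Finset.range n.2, p.2 1 j)
    by fun_prop)).congr hC.symm (ae_eq_refl _)

omit [IsProbabilityMeasure P] in
theorem measurable_count (hA : IsTwoFactorDriver P W N Y ρ lam m v) (T : ℝ≥0) :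
    Measurable fun ω ↦ (N 0 T ω, N 1 T ω) :=
  ((hA.poisson 0).measurable T).prodMk ((hA.poisson 1).measurable T)

omit [IsProbabilityMeasure P] in
theorem real_fiber (N : Fin 2 → ℝ≥0 → Ω → ℕ) (T : ℝ≥0) (n : ℕ × ℕ) :
    P.real ((fun ω ↦ (N 0 T ω, N 1 T ω)) ⁻¹' {n}) = jointWeight P N T n := by
  rw [jointWeight]
  congr 1
  ext ω
  simp [Prod.ext_iff]

/-- The mixture identity for deterministic variables, which are independent of everything. -/
theorem hasSum_jointWeight_mul_pow (hA : IsTwoFactorDriver P W N Y ρ lam m v) (T : ℝ≥0)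
    (x y : ℝ) :
    HasSum (fun n : ℕ × ℕ ↦ jointWeight P N T n * (x ^ n.1 * y ^ n.2))
      (∫ ω, x ^ N 0 T ω * y ^ N 1 T ω ∂P) := by
  have hint : Integrable (fun ω ↦ x ^ N 0 T ω * y ^ N 1 T ω) P := by
    -- The joint law of the counts is arbitrary, so the product is dominated by a sum of squares,
    -- which involves only the Poisson marginals.
    refine (((hA.poisson 0).integrable_pow T (x ^ 2)).add
      ((hA.poisson 1).integrable_pow T (y ^ 2))).mono' ?_ (.of_forall fun ω ↦ ?_)
    · exact ((measurable_from_nat.comp ((hA.poisson 0).measurable T)).mul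
        (measurable_from_nat.comp ((hA.poisson 1).measurable T))).aestronglyMeasurable
    · simp only [Pi.add_apply, ← pow_mul, mul_comm 2]
      rw [pow_mul, pow_mul, Real.norm_eq_abs, abs_le]
      constructor <;>
        nlinarith [sq_nonneg (x ^ N 0 T ω - y ^ N 1 T ω), sq_nonneg (x ^ N 0 T ω + y ^ N 1 T ω),
          sq_nonneg (x ^ N 0 T ω), sq_nonneg (y ^ N 1 T ω)]
  have h := hasSum_mixture (P := P) (Z := fun (n : ℕ × ℕ) _ ↦ x ^ n.1 * y ^ n.2)
    (hA.measurable_count T) (fun _ ↦ aestronglyMeasurable_const)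
    (fun _ ↦ indepFun_const_right _ _) hint
  simpa [real_fiber] using h

omit [IsProbabilityMeasure P] in
theorem jointWeight_mul_exp_eq_ssTerm (N : Fin 2 → ℝ≥0 → Ω → ℕ) (k M : ℝ) (ν T : ℝ≥0)
    (n : ℕ × ℕ) {a : ℝ≥0} (ha : (a : ℝ) = Real.exp (-k * T)) :
    jointWeight P N T n * Real.exp (n.1 * (a * M) + n.2 * M +
      (n.1 * (a ^ 2 * ν ^ 2) + n.2 * ν ^ 2 : ℝ≥0) / 2) = ssTerm P N k M ν T n := by
  rw [ssTerm, jumpMGF, jumpMGF, ← ha, mul_assoc, ← Real.exp_nat_mul, ← Real.exp_nat_mul,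
    ← Real.exp_add]
  push_cast
  ring_nf

theorem hasSum_ssTerm (hA : IsTwoFactorDriver P W N Y ρ lam m v) (k M : ℝ) (ν T : ℝ≥0) :
    HasSum (ssTerm P N k M ν T) (Real.exp (ssB P N k M ν T)) := by
  have h := hA.hasSum_jointWeight_mul_pow T (jumpMGF M ν (Real.exp (-k * T))) (jumpMGF M ν 1)
  have hsum : Summable (ssTerm P N k M ν T) :=
    h.summable.congr fun n ↦ by rw [ssTerm, mul_assoc]
  have h1 := hA.hasSum_jointWeight_mul_pow T 1 1
  simp only [one_pow, mul_one, integral_const, probReal_univ, smul_eq_mul] at h1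
  have hnn : ∀ n, 0 ≤ ssTerm P N k M ν T n := fun n ↦ by
    simp only [ssTerm, jointWeight, jumpMGF]
    positivity
  -- The logarithm in `ssB` is inverted by `exp` only if the series is positive: the joint weights
  -- sum to one by `h1`, so one of them is nonzero.
  have hpos : 0 < ∑' n, ssTerm P N k M ν T n := by
    obtain ⟨n, hn⟩ : ∃ n, jointWeight P N T n ≠ 0 := by
      by_contra! hcon
      simp only [hcon] at h1
      exact one_ne_zero (h1.unique hasSum_zero)
    refine hsum.tsum_pos hnn n ?_
    have : 0 < jointWeight P N T n := lt_of_le_of_ne measureReal_nonneg hn.symm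
    simp only [ssTerm, jumpMGF]
    positivity
  rw [ssB, Real.exp_log hpos]
  exact hsum.hasSum

end IsTwoFactorDriver

/-! ### Schwartz-Smith model plus jumps -/

section SchwartzSmith

variable {Ω : Type*} [MeasurableSpace Ω] {P : Measure Ω} [IsProbabilityMeasure P]
  {W : Fin 2 → ℝ≥0 → Ω → ℝ} {N : Fin 2 → ℝ≥0 → Ω → ℕ} {Y : Fin 2 → ℕ → Ω → ℝ} {I : ℝ≥0 → Ω → ℝ}
  {lam : Fin 2 → ℝ≥0} {ν : ℝ≥0} {ρ M u₁ u₂ k μ σ₁ σ₂ : ℝ} {F h : ℝ≥0 → ℝ}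

omit [MeasurableSpace Ω] in
theorem ssJump_eq (k : ℝ) (N : Fin 2 → ℝ≥0 → Ω → ℕ) (Y : Fin 2 → ℕ → Ω → ℝ) (T : ℝ≥0) (ω : Ω) :
    ssJump k N Y T ω = ∑ j ∈ Finset.range (N 0 T ω), (Real.exp (-k * T)).toNNReal * Y 0 j ω +
      ∑ j ∈ Finset.range (N 1 T ω), Y 1 j ω := by
  simp [ssJump, gouJump, compoundSum, Finset.mul_sum, Real.coe_toNNReal _ (Real.exp_pos _).le]

omit [IsProbabilityMeasure P] in
theorem exists_ae_eq_ssCont (hW : ∀ i t, Measurable (W i t)) {T : ℝ≥0}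
    (hI : IsWienerIntegral P (W 0) T (fun s ↦ Real.exp (-k * (T - s))) (I T))
    (u₁ u₂ μ σ₁ σ₂ c : ℝ) :
    ∃ Φ : (Fin 2 → ℝ≥0 → ℝ) → ℝ, Measurable Φ ∧
      (fun ω ↦ c + ssCont u₁ u₂ k μ σ₁ σ₂ I W T ω) =ᵐ[P] fun ω ↦ Φ (fun i s ↦ W i s ω) := by
  obtain ⟨Φ, hΦ, h⟩ := exists_ae_eq_gouCont (hW 0) hI u₁ σ₁ c
  refine ⟨fun w ↦ Φ (w 0) + (u₂ + μ * T + σ₂ * w 1 T), by fun_prop, ?_⟩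
  filter_upwards [h] with ω hω
  rw [ssCont, ← add_assoc, hω]

theorem ss_moments (hA : IsTwoFactorDriver P W N Y ρ lam M (ν ^ 2)) (hk : 0 < k) (hσ₁ : 0 < σ₁)
    (hF : ∀ t, 0 < F t)
    (hI : ∀ t : ℝ≥0, IsWienerIntegral P (W 0) t (fun s ↦ Real.exp (-k * (t - s))) (I t))
    (T : ℝ≥0) :
    P[ssCont u₁ u₂ k μ σ₁ σ₂ I W T] = u₁ * Real.exp (-k * T) + u₂ + μ * T ∧
    Var[ssCont u₁ u₂ k μ σ₁ σ₂ I W T; P] = ssVarCont k σ₁ σ₂ ρ T ∧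
    Integrable (fun ω ↦ Real.exp (ssCont u₁ u₂ k μ σ₁ σ₂ I W T ω)) P ∧
    ∫ ω, Real.exp (ssCont u₁ u₂ k μ σ₁ σ₂ I W T ω) ∂P = Real.exp (ssA u₁ u₂ k μ σ₁ σ₂ ρ T) ∧
    Integrable (fun ω ↦ Real.exp (ssJump k N Y T ω)) P ∧
    ∫ ω, Real.exp (ssJump k N Y T ω) ∂P = Real.exp (ssB P N k M ν T) ∧
    HasSum (ssTerm P N k M ν T) (Real.exp (ssB P N k M ν T)) ∧
    Integrable
      (forwardSpot F h (fun t ω ↦ ssCont u₁ u₂ k μ σ₁ σ₂ I W t ω + ssJump k N Y t ω) T) P ∧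
    (P[forwardSpot F h (fun t ω ↦ ssCont u₁ u₂ k μ σ₁ σ₂ I W t ω + ssJump k N Y t ω) T] = F T ↔
      h T = -ssA u₁ u₂ k μ σ₁ σ₂ ρ T - ssB P N k M ν T) := by
  obtain ⟨v, hv, hC⟩ := hasLaw_ssCont (fun i ↦ (hA.brownian i).toIsPreBrownianReal) hA.gaussian
    hA.covariance hk (hI T) hσ₁.ne' u₁ u₂ μ σ₂
  obtain ⟨Φ, hΦ, hae⟩ := exists_ae_eq_ssCont hA.measurable_W (hI T) u₁ u₂ μ σ₁ σ₂ 0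
  simp only [zero_add] at hae
  set a := (Real.exp (-k * T)).toNNReal with ha
  have ha' : (a : ℝ) = Real.exp (-k * T) := Real.coe_toNNReal _ (Real.exp_pos _).le
  have hB := hA.hasSum_ssTerm k M ν T
  have hb := hB
  simp only [funext fun n ↦ (IsTwoFactorDriver.jointWeight_mul_exp_eq_ssTerm
    (P := P) N k M ν T n ha').symm, ← IsTwoFactorDriver.real_fiber] at hb
  have hgA : Real.exp (u₁ * Real.exp (-k * T) + u₂ + μ * T + v / 2) =
      Real.exp (ssA u₁ u₂ k μ σ₁ σ₂ ρ T) := by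
    rw [hv, ssA]
    ring_nf
  obtain ⟨d1, d2⟩ := integral_exp_jump_mixture (hA.measurable_count T) (hA.hasLaw_sum a)
    (hA.indepFun_count_sum a T) hb
  obtain ⟨s1, s2⟩ := integral_exp_add_mixture (hA.measurable_count T) hC (hA.hasLaw_sum a)
    (fun n ↦ hA.indepFun_count_sum_prodMk a T n hΦ hae) (hA.indepFun_count_sum a T) hb
  simp only [ha, ← ssJump_eq] at d1 d2 s1 s2
  rw [hgA] at s2
  obtain ⟨c1, c2⟩ := integral_exp_of_hasLaw hC
  rw [hgA] at c2
  refine ⟨?_, ?_, c1, c2, d1, d2, hB, integrable_forwardSpot s1,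
    integral_forwardSpot_eq_iff (hF T) s2⟩
  · rw [hC.integral_eq, integral_id_gaussianReal]
  · rw [hC.variance_eq, variance_id_gaussianReal, hv]

theorem ss_optionPrices (hA : IsTwoFactorDriver P W N Y ρ lam M (ν ^ 2))
    (hρ : ρ ∈ Set.Icc (-1 : ℝ) 1) (hk : 0 < k) (hσ₁ : 0 < σ₁) (hσ₂ : 0 < σ₂) (hF : ∀ t, 0 < F t)
    (hI : ∀ t : ℝ≥0, IsWienerIntegral P (W 0) t (fun s ↦ Real.exp (-k * (t - s))) (I t))
    {S : ℝ≥0 → Ω → ℝ}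
    (hS : S = forwardSpot F h (fun t ω ↦ ssCont u₁ u₂ k μ σ₁ σ₂ I W t ω + ssJump k N Y t ω))
    {T : ℝ≥0} {r K : ℝ} (hT : 0 < T) (hK : 0 < K) (hST : P[S T] = F T) :
    Integrable (callPayoff K (S T)) P ∧
    HasSum (fun n : ℕ × ℕ ↦ jointWeight P N T n *
        bsCall (F T * Real.exp (ssP P N k M ν n T)) K r T
          (Var[ssCont u₁ u₂ k μ σ₁ σ₂ I W T; P] +
            (Real.exp (-2 * k * T) * n.1 + n.2) * (ν : ℝ) ^ 2) r)
      (riskNeutralPrice P r T (callPayoff K (S T))) ∧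
    HasSum (fun n : ℕ × ℕ ↦ jointWeight P N T n *
        bsPut (F T * Real.exp (ssP P N k M ν n T)) K r T
          (Var[ssCont u₁ u₂ k μ σ₁ σ₂ I W T; P] +
            (Real.exp (-2 * k * T) * n.1 + n.2) * (ν : ℝ) ^ 2) r)
      (riskNeutralPrice P r T (putPayoff K (S T))) := by
  obtain ⟨-, hVar, -, -, -, -, -, hint, hiff⟩ := ss_moments (h := h) (u₁ := u₁) (u₂ := u₂) (μ := μ)
    (σ₂ := σ₂) hA hk hσ₁ hF hI T
  obtain ⟨v, hv, hC⟩ := hasLaw_ssCont (fun i ↦ (hA.brownian i).toIsPreBrownianReal) hA.gaussian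
    hA.covariance hk (hI T) hσ₁.ne' u₁ u₂ μ σ₂
  obtain ⟨Φ, hΦ, hae⟩ := exists_ae_eq_ssCont hA.measurable_W (hI T) u₁ u₂ μ σ₁ σ₂
    (Real.log (F T) + h T)
  have hv0 : v ≠ 0 := by
    rintro rfl
    exact (ssVarCont_pos hρ hk hσ₁ hσ₂ hT).ne hv
  set a := (Real.exp (-k * T)).toNNReal with ha
  have ha' : (a : ℝ) = Real.exp (-k * T) := Real.coe_toNNReal _ (Real.exp_pos _).le
  have he2 : Real.exp (-2 * k * T) = (a : ℝ) ^ 2 := by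
    rw [ha', sq, ← Real.exp_add]
    ring_nf
  have hhT := hiff.1 (hS ▸ hST)
  have hSexp : S T = fun ω ↦ Real.exp (Real.log (F T) + h T + ssCont u₁ u₂ k μ σ₁ σ₂ I W T ω +
      (∑ j ∈ Finset.range (N 0 T ω), a * Y 0 j ω + ∑ j ∈ Finset.range (N 1 T ω), Y 1 j ω)) := by
    rw [hS, forwardSpot_eq_exp (hF T)]
    simp only [ha, ← ssJump_eq, add_assoc]
  rw [← hS, hSexp] at hint
  -- Again `q = r` because `F T` is a forward price; the mixing index is now the pair of jump
  -- counts.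
  obtain ⟨p1, p2⟩ := hasSum_optionPrices_add_mixture (r := r) (q := r) (T := T)
    (P₀ := fun n : ℕ × ℕ ↦ F T * Real.exp (ssP P N k M ν n T))
    (v := fun n : ℕ × ℕ ↦ Var[ssCont u₁ u₂ k μ σ₁ σ₂ I W T; P] +
      (Real.exp (-2 * k * T) * n.1 + n.2) * (ν : ℝ) ^ 2)
    hK (hA.measurable_count T) (gaussianReal_const_add hC (Real.log (F T) + h T))
    (hA.hasLaw_sum a) (fun n ↦ hA.indepFun_count_sum_prodMk a T n hΦ hae)
    (hA.indepFun_count_sum a T) hv0 (fun n ↦ by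
      rw [hVar, hv, he2]
      push_cast
      ring) (fun n ↦ by
      rw [sub_self, zero_mul, Real.exp_zero, mul_one, ← Real.exp_log (hF T), ← Real.exp_add,
        Real.exp_log (hF T), hhT, hVar, ssA, ssP, ← ha', he2]
      ring_nf) hint
  simp only [IsTwoFactorDriver.real_fiber] at p1 p2
  rw [hSexp]
  exact ⟨integrable_call_of_integrable K hint, p1, p2⟩

end SchwartzSmith

/-! ### Assembly of the three models -/

theorem mainTheorem1 {Ω : Type*} [MeasurableSpace Ω] (P : Measure Ω) [IsProbabilityMeasure P] :
    -- Geometric Ornstein-Uhlenbeck process plus jumps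
    (∀ (W : ℝ≥0 → Ω → ℝ) (N : ℝ≥0 → Ω → ℕ) (Y : ℕ → Ω → ℝ) (I : ℝ≥0 → Ω → ℝ) (lam ν : ℝ≥0) (M u₀ k σ : ℝ)
        (F h : ℝ≥0 → ℝ),
      IsAssetDriver P W N Y lam M (ν ^ 2) → 0 < k → 0 < σ → (∀ t, 0 < F t) →
      (∀ t : ℝ≥0, IsWienerIntegral P W t (fun s ↦ Real.exp (-k * (t - s))) (I t)) →
      ∀ (UC UD S : ℝ≥0 → Ω → ℝ), UC = gouCont u₀ k σ I → UD = gouJump k N Y →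
      S = forwardSpot F h (fun t ω ↦ UC t ω + UD t ω) →
      (∀ T : ℝ≥0,
        P[UC T] = u₀ * Real.exp (-k * T) ∧
        Var[UC T; P] = σ ^ 2 / (2 * k) * (1 - Real.exp (-2 * k * T)) ∧
        Integrable (fun ω ↦ Real.exp (UC T ω)) P ∧
        ∫ ω, Real.exp (UC T ω) ∂P = Real.exp (gouA u₀ k σ T) ∧
        Integrable (fun ω ↦ Real.exp (UD T ω)) P ∧
        ∫ ω, Real.exp (UD T ω) ∂P = Real.exp (gouB k lam M ν T) ∧
        Integrable (S T) P ∧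
        (P[S T] = F T ↔ h T = -gouA u₀ k σ T - gouB k lam M ν T)) ∧
      (∀ (T : ℝ≥0) (r K : ℝ), 0 < T → 0 < K → P[S T] = F T →
        Integrable (callPayoff K (S T)) P ∧
        HasSum (fun n : ℕ ↦ poissonWeight n (lam * T) *
            bsCall (F T * Real.exp (gouP k lam M ν n T)) K r T
              (Var[UC T; P] + n * Real.exp (-2 * k * T) * (ν : ℝ) ^ 2) r)
          (riskNeutralPrice P r T (callPayoff K (S T))) ∧
        HasSum (fun n : ℕ ↦ poissonWeight n (lam * T) *
            bsPut (F T * Real.exp (gouP k lam M ν n T)) K r T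
              (Var[UC T; P] + n * Real.exp (-2 * k * T) * (ν : ℝ) ^ 2) r)
          (riskNeutralPrice P r T (putPayoff K (S T))))) ∧
    -- Geometric Brownian motion plus jumps
    (∀ (W : ℝ≥0 → Ω → ℝ) (N : ℝ≥0 → Ω → ℕ) (Z : ℕ → Ω → ℝ) (lam ν : ℝ≥0) (S₀ μ σ M r : ℝ),
      IsAssetDriver P W N Z lam 0 1 → 0 < S₀ → 0 < σ → 0 < M →
      ∀ (S : ℝ≥0 → Ω → ℝ), S = gbmSpot S₀ μ σ M ν W N Z →
      (∀ n, Integrable (gbmJump M ν Z n) P ∧ P[gbmJump M ν Z n] = M) ∧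
      (∀ T : ℝ≥0, Integrable (S T) P) ∧
      (∀ T : ℝ≥0, 0 < T →
        (P[S T] = S₀ * Real.exp (r * T) ↔
          μ - r = -lam * ∫ ω, (gbmJump M ν Z 0 ω - 1) ∂P)) ∧
      (∀ (T : ℝ≥0) (K : ℝ), 0 < T → 0 < K →
        μ - r = -lam * ∫ ω, (gbmJump M ν Z 0 ω - 1) ∂P →
        Integrable (callPayoff K (S T)) P ∧
        HasSum (fun n : ℕ ↦ poissonWeight n (lam * T) *
            bsCall (gbmStart S₀ M lam T n) K r T (gbmVar σ ν T n) 0)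
          (riskNeutralPrice P r T (callPayoff K (S T))) ∧
        HasSum (fun n : ℕ ↦ poissonWeight n (lam * T) *
            bsPut (gbmStart S₀ M lam T n) K r T (gbmVar σ ν T n) 0)
          (riskNeutralPrice P r T (putPayoff K (S T))))) ∧
    -- Schwartz-Smith model plus jumps
    (∀ (W : Fin 2 → ℝ≥0 → Ω → ℝ) (N : Fin 2 → ℝ≥0 → Ω → ℕ) (Y : Fin 2 → ℕ → Ω → ℝ) (I : ℝ≥0 → Ω → ℝ)
        (lam : Fin 2 → ℝ≥0) (ν : ℝ≥0) (ρ M u₁ u₂ k μ σ₁ σ₂ : ℝ) (F h : ℝ≥0 → ℝ),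
      IsTwoFactorDriver P W N Y ρ lam M (ν ^ 2) →
      ρ ∈ Set.Icc (-1 : ℝ) 1 → 0 < k → 0 < σ₁ → 0 < σ₂ → (∀ t, 0 < F t) →
      (∀ t : ℝ≥0, IsWienerIntegral P (W 0) t (fun s ↦ Real.exp (-k * (t - s))) (I t)) →
      ∀ (UC UD S : ℝ≥0 → Ω → ℝ), UC = ssCont u₁ u₂ k μ σ₁ σ₂ I W → UD = ssJump k N Y →
      S = forwardSpot F h (fun t ω ↦ UC t ω + UD t ω) →
      (∀ T : ℝ≥0,
        P[UC T] = u₁ * Real.exp (-k * T) + u₂ + μ * T ∧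
        Var[UC T; P] = ssVarCont k σ₁ σ₂ ρ T ∧
        Integrable (fun ω ↦ Real.exp (UC T ω)) P ∧
        ∫ ω, Real.exp (UC T ω) ∂P = Real.exp (ssA u₁ u₂ k μ σ₁ σ₂ ρ T) ∧
        Integrable (fun ω ↦ Real.exp (UD T ω)) P ∧
        ∫ ω, Real.exp (UD T ω) ∂P = Real.exp (ssB P N k M ν T) ∧
        HasSum (ssTerm P N k M ν T) (Real.exp (ssB P N k M ν T)) ∧
        Integrable (S T) P ∧
        (P[S T] = F T ↔ h T = -ssA u₁ u₂ k μ σ₁ σ₂ ρ T - ssB P N k M ν T)) ∧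
      (∀ (T : ℝ≥0) (r K : ℝ), 0 < T → 0 < K → P[S T] = F T →
        Integrable (callPayoff K (S T)) P ∧
        HasSum (fun n : ℕ × ℕ ↦ jointWeight P N T n *
            bsCall (F T * Real.exp (ssP P N k M ν n T)) K r T
              (Var[UC T; P] + (Real.exp (-2 * k * T) * n.1 + n.2) * (ν : ℝ) ^ 2) r)
          (riskNeutralPrice P r T (callPayoff K (S T))) ∧
        HasSum (fun n : ℕ × ℕ ↦ jointWeight P N T n *
            bsPut (F T * Real.exp (ssP P N k M ν n T)) K r T
              (Var[UC T; P] + (Real.exp (-2 * k * T) * n.1 + n.2) * (ν : ℝ) ^ 2) r)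
          (riskNeutralPrice P r T (putPayoff K (S T))))) := by
  refine ⟨?_, ?_, ?_⟩
  · rintro W N Y I lam ν M u₀ k σ F h hA hk hσ hF hI UC UD S rfl rfl rfl
    exact ⟨fun T ↦ gou_moments hA hk hF hI T,
      fun T r K hT hK hST ↦ gou_optionPrices hA hk hσ hF hI rfl hT hK hST⟩
  · rintro W N Z lam ν S₀ μ σ M r hA hS₀ hσ hM S rfl
    have hJ : ∀ n, Integrable (gbmJump M ν Z n) P ∧ P[gbmJump M ν Z n] = M := fun n ↦
      integral_gbmJump (hA.law_mark n) M ν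
    have hJ0 : ∫ ω, (gbmJump M ν Z 0 ω - 1) ∂P = M - 1 := by
      rw [integral_sub (hJ 0).1 (integrable_const 1), (hJ 0).2]
      simp
    simp only [hJ0]
    refine ⟨hJ, fun T ↦ (integral_gbmSpot hA hS₀ hM T).1,
      fun T hT ↦ integral_gbmSpot_eq_iff hA hS₀ hM hT, fun T K hT hK hμ ↦
      ⟨integrable_call_of_integrable K (integral_gbmSpot hA hS₀ hM T).1,
        gbm_optionPrices hA hS₀ hσ hM hT hK hμ⟩⟩
  · rintro W N Y I lam ν ρ M u₁ u₂ k μ σ₁ σ₂ F h hA hρ hk hσ₁ hσ₂ hF hI UC UD S rfl rfl rfl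
    exact ⟨fun T ↦ ss_moments hA hk hσ₁ hF hI T,
      fun T r K hT hK hST ↦ ss_optionPrices hA hρ hk hσ₁ hσ₂ hF hI rfl hT hK hST⟩
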